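/- Let $X$ be a compact metric space with Borel $\sigma$-algebra $\mathcal B_X$, let $T=(T^{(m,n)})_{(m,n)\in\mathbb Z^2}$ be an action of $\mathbb Z^2$ on $X$ by homeomorphisms, and let $\mu$ be a $T$-invariant Borel probability measure on $X$. Write $U_T^{(m,n)}f=f\circ T^{(m,n)}$ for $f$ in the complex Hilbert space $L^2(X,\mathcal B_X,\mu)$. Let $\beta\in\mathbb R$ and $\vec v=(1,\beta)$; for $b>0$ and $k\in\mathbb N$ put $$\Lambda^{\vec v}(b)=\{(m,n)\in\mathbb Z^2:\beta m-b/2\le n\le\beta m+b/2\},\qquad \Lambda^{\vec v}_k(b)=\Lambda^{\vec v}(b)\cap([0,k-1]\times\mathbb Z).$$ For $c>0$ let $\mathcal K^{\vec v}_\mu(c)$ be the collection of all $B\in\mathcal B_X$ such that the closure of $\{U_T^{(m,n)}1_B:(m,n)\in\Lambda^{\vec v}(c)\}$ is compact in $L^2(X,\mathcal B_X,\mu)$. The system $(X,\mathcal B_X,\mu,T)$ is called $\vec v$-weak mixing if every $B\in\mathcal K^{\vec v}_\mu(c)$ has $\mu(B)=0$ or $\mu(B)=1$. **Theorem.** Let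 $b,c\in(0,\infty)$. The following are equivalent. (a) $(X,\mathcal B_X,\mu,T)$ is $\vec v$-weak mixing (with respect to $\mathcal K^{\vec v}_\mu(c)$; since $b$ and $c$ are arbitrary, the notion does not depend on $c$). (b) For every infinite subset $Q$ of $\Lambda^{\vec v}(b)$ with $$\liminf_{k\to\infty}\frac{\#(Q\cap([0,k-1]\times\mathbb Z))}{\#\Lambda^{\vec v}_k(b)}>0,$$ and every enumeration $Q=\{(m_i,n_i)\}_{i=1}^\infty$ without repetition such that $|m_1|\le|m_2|\le\cdots$ (that is, $m_1\le m_2\le\cdots$ if $Q\subset\mathbb Z_{\ge0}\times\mathbb Z$), one has $$\lim_{N\to\infty}\Big\|\frac1N\sum_{i=1}^N U_T^{(m_i,n_i)}f-\int_X f\,d\mu\Big\|_2=0\qquad\text{for all } f\in L^2(X,\mathcal B_X,\mu).$$ -/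

import Mathlib

open MeasureTheory Filter Topology

noncomputable section

namespace DirectionalWeakMixing

/-- The strip of width `b` around the line of direction `(1, β)`:
the lattice points `(m, n)` with `β m - b / 2 ≤ n ≤ β m + b / 2`. -/
def strip (β b : ℝ) : Set (ℤ × ℤ) :=
  {p | β * (p.1 : ℝ) - b / 2 ≤ (p.2 : ℝ) ∧ (p.2 : ℝ) ≤ β * (p.1 : ℝ) + b / 2}

/-- The slab `[0, k - 1] × ℤ`. -/
def slab (k : ℕ) : Set (ℤ × ℤ) := {p | 0 ≤ p.1 ∧ p.1 ≤ (k : ℤ) - 1}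

/-- The lower density of `Q` relative to the strip: the lower limit of
`#(Q ∩ ([0, k - 1] × ℤ)) / #(strip ∩ ([0, k - 1] × ℤ))`. -/
def lowerRelDensity (β b : ℝ) (Q : Set (ℤ × ℤ)) : ℝ :=
  liminf (fun k : ℕ => ((Q ∩ slab k).ncard : ℝ) / ((strip β b ∩ slab k).ncard : ℝ)) atTop

section System

variable {X : Type*} [MeasurableSpace X] [AddAction (ℤ × ℤ) X] [MeasurableConstVAdd (ℤ × ℤ) X]
  (μ : Measure X) [VAddInvariantMeasure (ℤ × ℤ) X μ]

/-- The Koopman operator `f ↦ f ∘ T^g` on complex `L²`, where `T^g x = g +ᵥ x`. -/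
def koopman (g : ℤ × ℤ) (f : Lp ℂ 2 μ) : Lp ℂ 2 μ :=
  Lp.compMeasurePreserving (fun x : X => g +ᵥ x) (measurePreserving_vadd g μ) f

/-- The directional Kronecker algebra, formed with the strip of width `c`: the measurable sets `B`
for which the orbit of the indicator function of `B` along the strip has compact closure in `L²`. -/
def kroneckerAlgebra [IsFiniteMeasure μ] (β c : ℝ) : Set (Set X) :=
  {B | ∃ hB : MeasurableSet B,
    IsCompact (closure ((fun g : ℤ × ℤ =>
      koopman μ g (indicatorConstLp 2 hB (measure_ne_top μ B) (1 : ℂ))) '' strip β c))}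

/-- Weak mixing in direction `(1, β)`: the directional Kronecker algebra is trivial modulo
null sets. -/
def IsWeakMixing [IsFiniteMeasure μ] (β c : ℝ) : Prop :=
  ∀ B ∈ kroneckerAlgebra μ β c, B =ᵐ[μ] (∅ : Set X) ∨ B =ᵐ[μ] (Set.univ : Set X)

end System

/-- `q 0, q 1, q 2, …` lists every element of `Q` exactly once, in order of nondecreasing
absolute value of the first coordinate. -/
structure IsOrderedEnumeration (Q : Set (ℤ × ℤ)) (q : ℕ → ℤ × ℤ) : Prop where
  injective : Function.Injective q
  range_eq : Set.range q = Q
  monotone_abs : Monotone fun i => |(q i).1|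

end DirectionalWeakMixing

end

/-!
Fix `f` and average the rank-one operators `⟪U_g f, ·⟫ U_g f` over a wide strip against nonnegative
weights of bounded mass that are asymptotically invariant under translation, up to an error
proportional to the distance of the translation from the line. Such averages have bounded trace, so
a weak operator limit along an ultrafilter is a positive operator `K` of finite trace, hence
compact. Moreover `K` commutes with `U_d` up to that error, so `U_d K f` is close to `K U_d f` for
`d` near the line, and the orbit of `K f` along a strip is totally bounded. If `f` is orthogonal to
all vectors with this property, then `⟪K f, f⟫ = 0`: the weighted averages of `|⟪U_g f, f⟫|²` tend
to `0`. By the Cauchy-Schwarz inequality, so do the averages of `U_g f` along every set of positive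
density in a strip.

Under weak mixing, the vectors with totally bounded orbit are constant, because almost all
superlevel sets of their real and imaginary parts lie in the Kronecker algebra. Conversely, if the
indicator function `1_B` has a totally bounded orbit, the times at which it returns `ε`-close to
itself have positive density. The averages of `1_B` along these times stay `ε`-close to `1_B`, so
their convergence to a constant forces `1_B` to be constant.
-/

namespace DirectionalWeakMixing

theorem exists_finset_dist_lt_of_totallyBounded_image {ι E : Type*} [PseudoMetricSpace E]
    {u : ι → E} {s : Set ι} (hu : TotallyBounded (u '' s)) {ε : ℝ} (hε : 0 < ε) :
    ∃ F : Finset ι, (F : Set ι) ⊆ s ∧ ∀ i ∈ s, ∃ j ∈ F, dist (u i) (u j) < ε := by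
  obtain ⟨F, hFs, hF, hcover⟩ :=
    Set.exists_subset_image_finite_and.1 (Metric.finite_approx_of_totallyBounded hu ε hε)
  refine ⟨hF.toFinset, by rwa [hF.coe_toFinset], fun i hi => ?_⟩
  obtain ⟨_, ⟨j, hj, rfl⟩, hij⟩ := Set.mem_iUnion₂.1 (hcover (Set.mem_image_of_mem u hi))
  exact ⟨j, hF.mem_toFinset.2 hj, hij⟩

theorem totallyBounded_image_of_dist_control {ι E F : Type*} [PseudoMetricSpace E]
    [PseudoMetricSpace F] {u : ι → E} {v : ι → F} {s : Set ι} (hu : TotallyBounded (u '' s))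
    (h : ∀ ε > 0, ∃ δ > 0, ∀ i ∈ s, ∀ j ∈ s, dist (u i) (u j) < δ → dist (v i) (v j) < ε) :
    TotallyBounded (v '' s) := by
  refine Metric.totallyBounded_iff.2 fun ε hε => ?_
  obtain ⟨δ, hδ, hδε⟩ := h ε hε
  obtain ⟨t, hts, ht⟩ := exists_finset_dist_lt_of_totallyBounded_image hu hδ
  refine ⟨v '' t, t.finite_toSet.image v, ?_⟩
  rintro _ ⟨i, hi, rfl⟩
  obtain ⟨j, hj, hij⟩ := ht i hi
  exact Set.mem_iUnion₂.2 ⟨v j, Set.mem_image_of_mem v hj, hδε i hi j (hts hj) hij⟩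

section WeakOperatorLimits

variable {𝕜 H : Type*} [RCLike 𝕜] [NormedAddCommGroup H] [InnerProductSpace 𝕜 H] [CompleteSpace H]
variable {ι : Type*}

open ContinuousLinearMapWOT

theorem norm_le_of_tendsto_wot {l : Filter ι} [l.NeBot] {T : ι → H →L[𝕜] H} {K : H →L[𝕜] H}
    (hT : Tendsto (fun n => ofCLM (T n)) l (𝓝 (ofCLM K))) {C : ℝ} (hC : ∀ᶠ n in l, ‖T n‖ ≤ C) :
    ‖K‖ ≤ C := by
  have hC0 : 0 ≤ C := hC.exists.elim fun n hn => (norm_nonneg _).trans hn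
  refine K.opNorm_le_of_re_inner_le hC0 fun x y hx hy => ?_
  have hyx := tendsto_iff_forall_inner_apply_tendsto.1 hT x y
  rw [inner_re_symm]
  refine le_of_tendsto ((RCLike.continuous_re.tendsto _).comp hyx) (hC.mono fun n hn => ?_)
  calc RCLike.re (inner 𝕜 y (T n x)) ≤ ‖y‖ * ‖T n x‖ := re_inner_le_norm _ _
    _ = ‖T n x‖ := by rw [hy, one_mul]
    _ ≤ C * ‖x‖ := (T n).le_of_opNorm_le hn x
    _ = C := by rw [hx, mul_one]

theorem tendsto_reApplyInnerSelf_of_tendsto_wot {l : Filter ι} {T : ι → H →L[𝕜] H}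
    {K : H →L[𝕜] H} (hT : Tendsto (fun n => ofCLM (T n)) l (𝓝 (ofCLM K))) (x : H) :
    Tendsto (fun n => (T n).reApplyInnerSelf x) l (𝓝 (K.reApplyInnerSelf x)) := by
  simp only [ContinuousLinearMap.reApplyInnerSelf_apply, inner_re_symm (𝕜 := 𝕜) _ x]
  exact (RCLike.continuous_re.tendsto _).comp (tendsto_iff_forall_inner_apply_tendsto.1 hT x x)

theorem isPositive_of_tendsto_wot {l : Filter ι} [l.NeBot] {T : ι → H →L[𝕜] H} {K : H →L[𝕜] H}
    (hT : Tendsto (fun n => ofCLM (T n)) l (𝓝 (ofCLM K))) (hpos : ∀ n, (T n).IsPositive) :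
    K.IsPositive := by
  have hlim (x y : H) : Tendsto (fun n => inner 𝕜 x (T n y)) l (𝓝 (inner 𝕜 x (K y))) :=
    tendsto_iff_forall_inner_apply_tendsto.1 hT y x
  refine K.isPositive_def.2 ⟨fun x y => tendsto_nhds_unique ?_ (hlim x y), fun x => ?_⟩
  · have hconj := (RCLike.continuous_conj.tendsto _).comp (hlim y x)
    simp only [Function.comp_def, inner_conj_symm] at hconj
    exact hconj.congr fun n => (hpos n).inner_left_eq_inner_right x y
  · exact ge_of_tendsto (tendsto_reApplyInnerSelf_of_tendsto_wot hT x)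
      (Eventually.of_forall fun n => (hpos n).re_inner_nonneg_left x)

theorem exists_tendsto_wot_of_norm_le (T : ι → H →L[𝕜] H) {C : ℝ} (hT : ∀ n, ‖T n‖ ≤ C)
    (𝒰 : Ultrafilter ι) : ∃ K : H →L[𝕜] H, Tendsto (fun n => ofCLM (T n)) 𝒰 (𝓝 (ofCLM K)) := by
  have hbound (x y : H) (n : ι) : ‖inner 𝕜 (T n x) y‖ ≤ C * ‖x‖ * ‖y‖ :=
    (norm_inner_le_norm _ _).trans (by gcongr; exact (T n).le_of_opNorm_le (hT n) x)
  have hconv (x y : H) : ∃ l : 𝕜, Tendsto (fun n => inner 𝕜 (T n x) y) 𝒰 (𝓝 l) := by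
    obtain ⟨l, -, hl⟩ := (isCompact_closedBall (0 : 𝕜) (C * ‖x‖ * ‖y‖)).ultrafilter_le_nhds
      (𝒰.map fun n => inner 𝕜 (T n x) y) (le_principal_iff.2 <| Filter.mem_map.2 <|
        univ_mem' fun n => mem_closedBall_zero_iff.2 (hbound x y n))
    exact ⟨l, hl⟩
  choose B hB using hconv
  have hB_eq (x y : H) (l : 𝕜) (h : Tendsto (fun n => inner 𝕜 (T n x) y) 𝒰 (𝓝 l)) : B x y = l :=
    tendsto_nhds_unique (hB x y) h
  let sesq : H →ₗ⋆[𝕜] H →ₗ[𝕜] 𝕜 := LinearMap.mk₂'ₛₗ (starRingEnd 𝕜) (RingHom.id 𝕜) B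
    (fun x x' y => hB_eq _ _ _ <| by
      simpa only [map_add, inner_add_left] using (hB x y).add (hB x' y))
    (fun a x y => hB_eq _ _ _ <| by
      simpa only [map_smul, inner_smul_left, smul_eq_mul] using
        (hB x y).const_mul ((starRingEnd 𝕜) a))
    (fun x y y' => hB_eq _ _ _ <| by
      simpa only [inner_add_right] using (hB x y).add (hB x y'))
    (fun a x y => hB_eq _ _ _ <| by
      simpa only [inner_smul_right, smul_eq_mul, RingHom.id_apply] using (hB x y).const_mul a)
  let K := InnerProductSpace.continuousLinearMapOfBilin (𝕜 := 𝕜) (sesq.mkContinuous₂ C fun x y =>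
    le_of_tendsto (hB x y).norm (Eventually.of_forall (hbound x y)))
  have hK (x y : H) : inner 𝕜 (K x) y = B x y :=
    InnerProductSpace.continuousLinearMapOfBilin_apply ..
  refine ⟨K, tendsto_iff_forall_inner_apply_tendsto.2 fun x y => ?_⟩
  simpa only [Function.comp_def, inner_conj_symm, ← hK] using!
    (RCLike.continuous_conj.tendsto _).comp (hB x y)

end WeakOperatorLimits

section TraceClass

variable {𝕜 H : Type*} [RCLike 𝕜] [NormedAddCommGroup H] [InnerProductSpace 𝕜 H]

theorem norm_apply_sq_le_of_isPositive {K : H →L[𝕜] H} (hK : K.IsPositive) (x : H) :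
    ‖K x‖ ^ 2 ≤ ‖K‖ * K.reApplyInnerSelf x := by
  let form : PreInnerProductSpace.Core 𝕜 H :=
    { inner := fun x y => inner 𝕜 (K x) y
      conj_inner_symm := fun x y => by
        rw [inner_conj_symm, hK.inner_left_eq_inner_right]
      re_inner_nonneg := hK.re_inner_nonneg_left
      add_left := fun x y z => by rw [map_add, inner_add_left]
      smul_left := fun x y r => by rw [map_smul, inner_smul_left] }
  have cauchySchwarz : ‖inner 𝕜 (K x) (K x)‖ * ‖inner 𝕜 (K (K x)) x‖ ≤
      K.reApplyInnerSelf x * K.reApplyInnerSelf (K x) :=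
    InnerProductSpace.Core.inner_mul_inner_self_le (c := form) x (K x)
  rw [hK.inner_left_eq_inner_right (K x), ← inner_self_re_eq_norm, inner_self_eq_norm_sq]
    at cauchySchwarz
  have hKx : K.reApplyInnerSelf (K x) ≤ ‖K‖ * ‖K x‖ ^ 2 :=
    (re_inner_le_norm _ _).trans (by nlinarith [K.le_opNorm (K x), norm_nonneg (K x)])
  rcases (sq_nonneg ‖K x‖).eq_or_lt with h0 | hpos
  · rw [← h0]
    exact mul_nonneg (norm_nonneg K) (hK.re_inner_nonneg_left x)
  · refine le_of_mul_le_mul_right (cauchySchwarz.trans ?_) hpos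
    calc K.reApplyInnerSelf x * K.reApplyInnerSelf (K x)
        ≤ K.reApplyInnerSelf x * (‖K‖ * ‖K x‖ ^ 2) :=
          mul_le_mul_of_nonneg_left hKx (hK.re_inner_nonneg_left x)
      _ = ‖K‖ * K.reApplyInnerSelf x * ‖K x‖ ^ 2 := by ring

theorem orthonormal_insert {s : Finset H} [DecidableEq H] (hs : Orthonormal 𝕜 ((↑) : s → H))
    {e : H} (he : e ∈ (Submodule.span 𝕜 (s : Set H))ᗮ) (hnorm : ‖e‖ = 1) :
    Orthonormal 𝕜 ((↑) : ↥(insert e s) → H) := by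
  have hse (v : H) (hv : v ∈ s) : inner 𝕜 v e = 0 :=
    (Submodule.mem_orthogonal _ _).1 he v (Submodule.subset_span hv)
  refine ⟨fun ⟨v, hv⟩ => ?_, fun ⟨v, hv⟩ ⟨w, hw⟩ hvw => ?_⟩
  · rcases Finset.mem_insert.1 hv with rfl | hv
    · exact hnorm
    · exact hs.1 ⟨v, hv⟩
  · rcases Finset.mem_insert.1 hv with rfl | hvs <;> rcases Finset.mem_insert.1 hw with rfl | hws
    · exact absurd rfl hvw
    · exact inner_eq_zero_symm.1 (hse w hws)
    · exact hse v hvs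
    · exact hs.2 (i := ⟨v, hvs⟩) (j := ⟨w, hws⟩) fun h => hvw (by
        rwa [Subtype.mk.injEq] at h ⊢)

theorem exists_reApplyInnerSelf_le_on_orthogonal {K : H →L[𝕜] H} {D : ℝ}
    (htrace : ∀ s : Finset H, Orthonormal 𝕜 ((↑) : s → H) → ∑ v ∈ s, K.reApplyInnerSelf v ≤ D)
    {η : ℝ} (hη : 0 < η) :
    ∃ s : Finset H, ∀ x ∈ (Submodule.span 𝕜 (s : Set H))ᗮ, K.reApplyInnerSelf x ≤ η * ‖x‖ ^ 2 := by
  classical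
  let traces : Set ℝ :=
    {t | ∃ s : Finset H, Orthonormal 𝕜 ((↑) : s → H) ∧ ∑ v ∈ s, K.reApplyInnerSelf v = t}
  have hne : traces.Nonempty := ⟨0, ∅, by simp [Orthonormal, Pairwise]⟩
  have hbdd : BddAbove traces := ⟨D, by rintro _ ⟨s, hs, rfl⟩; exact htrace s hs⟩
  obtain ⟨_, ⟨s, hs, rfl⟩, hlt⟩ := exists_lt_of_lt_csSup hne (sub_lt_self (sSup traces) hη)
  have hunit (e : H) (he : e ∈ (Submodule.span 𝕜 (s : Set H))ᗮ) (hnorm : ‖e‖ = 1) :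
      K.reApplyInnerSelf e ≤ η := by
    have hes : e ∉ s := fun hes => one_ne_zero (α := ℝ) <| by
      rw [← hnorm, norm_eq_zero, ← inner_self_eq_zero (𝕜 := 𝕜)]
      exact (Submodule.mem_orthogonal _ _).1 he e (Submodule.subset_span hes)
    have hle := le_csSup hbdd ⟨_, orthonormal_insert hs he hnorm, rfl⟩
    rw [Finset.sum_insert hes] at hle
    linarith
  refine ⟨s, fun x hx => ?_⟩
  rcases eq_or_ne x 0 with rfl | hx0
  · simp [ContinuousLinearMap.reApplyInnerSelf_apply]
  · have hscale := hunit _ (Submodule.smul_mem _ ((‖x‖⁻¹ : ℝ) : 𝕜) hx) (by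
      rw [norm_smul, RCLike.norm_ofReal, abs_inv, abs_norm,
        inv_mul_cancel₀ (norm_ne_zero_iff.2 hx0)])
    rw [K.reApplyInnerSelf_smul, RCLike.norm_ofReal, abs_inv, abs_norm, inv_pow,
      inv_mul_le_iff₀ (by positivity)] at hscale
    rwa [mul_comm]

theorem isCompactOperator_of_isPositive_of_trace_le [CompleteSpace H] {K : H →L[𝕜] H}
    (hK : K.IsPositive) {D : ℝ}
    (htrace : ∀ s : Finset H, Orthonormal 𝕜 ((↑) : s → H) → ∑ v ∈ s, K.reApplyInnerSelf v ≤ D) :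
    IsCompactOperator K := by
  refine isClosed_setOfPred_isCompactOperator.closure_subset
    (Metric.mem_closure_iff.2 fun ε hε => ?_)
  obtain ⟨η, hη, hηε⟩ := exists_pos_mul_lt (pow_pos (half_pos hε) 2) ‖K‖
  obtain ⟨s, hs⟩ := exists_reApplyInnerSelf_le_on_orthogonal htrace hη
  let V := Submodule.span 𝕜 (s : Set H)
  have : FiniteDimensional 𝕜 V := FiniteDimensional.span_finset 𝕜 s
  have : ProperSpace V := FiniteDimensional.proper_rclike 𝕜 V
  refine ⟨K ∘L V.starProjection, ?_, ?_⟩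
  · exact (isCompactOperator_of_locallyCompactSpace_dom V.orthogonalProjectionOnto).clm_comp
      (K ∘L V.subtypeL)
  · refine lt_of_le_of_lt ?_ (half_lt_self hε)
    rw [dist_eq_norm]
    refine ContinuousLinearMap.opNorm_le_bound _ (half_pos hε).le fun x => ?_
    have hperp : x - V.starProjection x ∈ Vᗮ := V.sub_starProjection_mem_orthogonal x
    have hnorm : ‖x - V.starProjection x‖ ≤ ‖x‖ := by
      simpa using Vᗮ.norm_starProjection_apply_le x
    rw [sub_apply, ContinuousLinearMap.comp_apply, ← map_sub]
    refine le_of_sq_le_sq ?_ (by positivity)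
    calc ‖K (x - V.starProjection x)‖ ^ 2
        ≤ ‖K‖ * K.reApplyInnerSelf (x - V.starProjection x) := norm_apply_sq_le_of_isPositive hK _
      _ ≤ ‖K‖ * (η * ‖x‖ ^ 2) := by
        gcongr
        exact (hs _ hperp).trans (by gcongr)
      _ ≤ (ε / 2 * ‖x‖) ^ 2 := by
        rw [← mul_assoc, mul_pow]
        gcongr

end TraceClass

section FrameOperators

variable {H ι : Type*} [NormedAddCommGroup H] [InnerProductSpace ℂ H]

open InnerProductSpace
open ContinuousLinearMapWOT (ofCLM)

/-- The weighted frame operator `∑ i, w i • ⟪u i, ·⟫ u i` of a family of vectors `u`, as a linear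
function of the finitely supported weight `w`. -/
noncomputable def frameOperator (u : ι → H) : (ι →₀ ℝ) →ₗ[ℝ] H →L[ℂ] H :=
  Finsupp.linearCombination ℝ fun i => rankOne ℂ (u i) (u i)

theorem frameOperator_eq_sum (u : ι → H) (w : ι →₀ ℝ) :
    frameOperator u w = ∑ i ∈ w.support, w i • rankOne ℂ (u i) (u i) :=
  Finsupp.linearCombination_apply ℝ w

theorem reApplyInnerSelf_frameOperator (u : ι → H) (w : ι →₀ ℝ) (x : H) :
    (frameOperator u w).reApplyInnerSelf x = ∑ i ∈ w.support, w i * ‖inner ℂ (u i) x‖ ^ 2 := by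
  simp only [frameOperator_eq_sum, ContinuousLinearMap.reApplyInnerSelf_apply, sum_apply,
    smul_apply, rankOne_apply, sum_inner, map_sum]
  refine Finset.sum_congr rfl fun i _ => ?_
  rw [← Complex.coe_smul (w i), inner_smul_left, inner_smul_left, RCLike.conj_mul,
    Complex.conj_ofReal]
  rw [RCLike.re_eq_complex_re, Complex.re_ofReal_mul, ← RCLike.ofReal_pow]
  exact congrArg (w i * ·) (Complex.ofReal_re _)

theorem isPositive_frameOperator (u : ι → H) {w : ι →₀ ℝ} (hw : 0 ≤ w) :
    (frameOperator u w).IsPositive := by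
  rw [frameOperator_eq_sum]
  refine ContinuousLinearMap.isPositive_sum _ fun i _ => ?_
  rw [← Complex.coe_smul]
  exact (isPositive_rankOne_self (u i)).smul_of_nonneg (Complex.zero_le_real.2 (hw i))

variable {u : ι → H} {M : ℝ}

theorem norm_frameOperator_le (hu : ∀ i, ‖u i‖ ≤ M) (w : ι →₀ ℝ) :
    ‖frameOperator u w‖ ≤ (∑ i ∈ w.support, |w i|) * M ^ 2 := by
  rw [frameOperator_eq_sum, Finset.sum_mul]
  refine norm_sum_le_of_le _ fun i _ => ?_
  rw [norm_smul, norm_rankOne, Real.norm_eq_abs, ← sq]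
  gcongr
  exact hu i

theorem sum_reApplyInnerSelf_frameOperator_le (hu : ∀ i, ‖u i‖ ≤ M) (w : ι →₀ ℝ) {s : Finset H}
    (hs : Orthonormal ℂ ((↑) : s → H)) :
    ∑ v ∈ s, (frameOperator u w).reApplyInnerSelf v ≤ (∑ i ∈ w.support, |w i|) * M ^ 2 := by
  have bessel (x : H) : ∑ v ∈ s, ‖inner ℂ x v‖ ^ 2 ≤ ‖x‖ ^ 2 := by
    simp_rw [norm_inner_symm x]
    rw [← Finset.sum_coe_sort]
    exact hs.sum_inner_products_le x
  simp_rw [reApplyInnerSelf_frameOperator]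
  rw [Finset.sum_comm, Finset.sum_mul]
  refine Finset.sum_le_sum fun i _ => ?_
  rw [← Finset.mul_sum]
  have hi : ∑ v ∈ s, ‖inner ℂ (u i) v‖ ^ 2 ≤ M ^ 2 := (bessel (u i)).trans (by gcongr; exact hu i)
  gcongr
  exact le_abs_self _

theorem exists_isCompactOperator_tendsto_frameOperator [CompleteSpace H] (hu : ∀ i, ‖u i‖ ≤ M)
    {κ : Type*} (𝒰 : Ultrafilter κ) {w : κ → ι →₀ ℝ} (hw : ∀ n, 0 ≤ w n) {W : ℝ}
    (hW : ∀ n, ∑ i ∈ (w n).support, |w n i| ≤ W) :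
    ∃ K : H →L[ℂ] H, IsCompactOperator K ∧
      Tendsto (fun n => ofCLM (frameOperator u (w n))) 𝒰 (𝓝 (ofCLM K)) := by
  have hWM (n : κ) : (∑ i ∈ (w n).support, |w n i|) * M ^ 2 ≤ W * M ^ 2 := by
    gcongr
    exact hW n
  obtain ⟨K, hK⟩ := exists_tendsto_wot_of_norm_le (fun n => frameOperator u (w n))
    (fun n => (norm_frameOperator_le hu (w n)).trans (hWM n)) 𝒰
  refine ⟨K, isCompactOperator_of_isPositive_of_trace_le (D := W * M ^ 2)
    (isPositive_of_tendsto_wot hK fun n => isPositive_frameOperator u (hw n)) fun s hs => ?_, hK⟩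
  have hlim (v : H) : Tendsto (fun n => (frameOperator u (w n)).reApplyInnerSelf v) 𝒰
      (𝓝 (K.reApplyInnerSelf v)) := tendsto_reApplyInnerSelf_of_tendsto_wot hK v
  exact le_of_tendsto (tendsto_finsetSum s fun v _ => hlim v) (Eventually.of_forall fun n =>
    (sum_reApplyInnerSelf_frameOperator_le hu (w n) hs).trans (hWM n))

theorem comp_frameOperator (V : H →ₗᵢ[ℂ] H) {σ : ι → ι} (hV : ∀ i, V (u i) = u (σ i))
    (w : ι →₀ ℝ) :
    V.toContinuousLinearMap ∘L frameOperator u w =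
      frameOperator u (w.mapDomain σ) ∘L V.toContinuousLinearMap := by
  have hlin : frameOperator u (w.mapDomain σ) = frameOperator (u ∘ σ) w :=
    Finsupp.linearCombination_mapDomain ℝ σ w
  ext x
  simp only [hlin, frameOperator_eq_sum, ContinuousLinearMap.comp_apply, sum_apply, smul_apply,
    Function.comp_apply, rankOne_apply, map_sum, V.coe_toContinuousLinearMap, ← hV, V.inner_map_map,
    ← Complex.coe_smul (w _), map_smul]

theorem norm_commutator_frameOperator_le (hu : ∀ i, ‖u i‖ ≤ M) (V : H →ₗᵢ[ℂ] H) {σ : ι → ι}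
    (hV : ∀ i, V (u i) = u (σ i)) (w : ι →₀ ℝ) :
    ‖V.toContinuousLinearMap ∘L frameOperator u w - frameOperator u w ∘L V.toContinuousLinearMap‖ ≤
      (∑ i ∈ (w.mapDomain σ - w).support, |(w.mapDomain σ - w) i|) * M ^ 2 := by
  rw [comp_frameOperator V hV, ← ContinuousLinearMap.sub_comp, ← map_sub]
  calc ‖frameOperator u (w.mapDomain σ - w) ∘L V.toContinuousLinearMap‖
      ≤ ‖frameOperator u (w.mapDomain σ - w)‖ * 1 :=
        (ContinuousLinearMap.opNorm_comp_le _ _).trans (by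
          gcongr
          exact V.norm_toContinuousLinearMap_le)
    _ ≤ _ := (mul_one _).trans_le (norm_frameOperator_le hu _)

end FrameOperators

theorem totallyBounded_of_subset_thickening {E : Type*} [PseudoMetricSpace E] {s : Set E}
    (h : ∀ ε > 0, ∃ t, TotallyBounded t ∧ s ⊆ Metric.thickening ε t) : TotallyBounded s := by
  refine Metric.totallyBounded_iff.2 fun ε hε => ?_
  obtain ⟨t, ht, hst⟩ := h (ε / 2) (half_pos hε)
  obtain ⟨F, hF, htF⟩ := Metric.totallyBounded_iff.1 ht (ε / 2) (half_pos hε)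
  refine ⟨F, hF, fun x hx => ?_⟩
  obtain ⟨y, hy, hxy⟩ := Metric.mem_thickening_iff.1 (hst hx)
  obtain ⟨z, hz, hyz⟩ := Set.mem_iUnion₂.1 (htF hy)
  refine Set.mem_iUnion₂.2 ⟨z, hz, Metric.mem_ball.2 ?_⟩
  linarith [dist_triangle x y z, Metric.mem_ball.1 hyz]

theorem mul_sum_sub_le_card_mul_sum {G : Type*} [AddGroup G] (s : Finset G) {w : G →₀ ℝ}
    (hw : 0 ≤ w) {δ : ℝ} (hδ : ∀ g ∈ s, ∀ h ∈ s, δ ≤ w (g - h)) {c : G → ℝ} (hc : 0 ≤ c) :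
    δ * ∑ p ∈ s ×ˢ s, c (p.1 - p.2) ≤ s.card * ∑ k ∈ w.support, w k * c k := by
  classical
  have hrow (g : G) : ∑ h ∈ s, w (g - h) * c (g - h) ≤ ∑ k ∈ w.support, w k * c k := by
    rw [← Finset.sum_image (f := fun k => w k * c k) sub_right_injective.injOn,
      ← Finset.sum_filter_ne_zero]
    refine Finset.sum_le_sum_of_subset_of_nonneg (fun k hk => ?_) fun k _ _ =>
      mul_nonneg (hw k) (hc k)
    exact Finsupp.mem_support_iff.2 (left_ne_zero_of_mul (Finset.mem_filter.1 hk).2)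
  rw [Finset.sum_product, Finset.mul_sum]
  calc ∑ g ∈ s, δ * ∑ h ∈ s, c (g - h) ≤ ∑ _g ∈ s, ∑ k ∈ w.support, w k * c k := by
        refine Finset.sum_le_sum fun g hg => (hrow g).trans' ?_
        rw [Finset.mul_sum]
        exact Finset.sum_le_sum fun h hh =>
          mul_le_mul_of_nonneg_right (hδ g hg h hh) (hc (g - h))
    _ = s.card * ∑ k ∈ w.support, w k * c k := by rw [Finset.sum_const, nsmul_eq_mul]

section Representations

variable {G H : Type*} [AddCommGroup G] [NormedAddCommGroup H] [InnerProductSpace ℂ H]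

open scoped Pointwise
open ContinuousLinearMapWOT (ofCLM)

/-- Nonnegative finitely supported weights on a group, of mass at most `W`, whose translates by `d`
are asymptotically within `ρ d` of themselves in `ℓ¹`: almost invariance up to the error `ρ`. -/
structure IsAlmostInvariant (w : ℕ → G →₀ ℝ) (W : ℝ) (ρ : G → ℝ) : Prop where
  nonneg (n : ℕ) : 0 ≤ w n
  sum_le (n : ℕ) : ∑ g ∈ (w n).support, |w n g| ≤ W
  sum_translate_sub_le (d : G) (ε : ℝ) (hε : 0 < ε) : ∀ᶠ n in atTop,
    ∑ g ∈ ((w n).mapDomain (d + ·) - w n).support, |((w n).mapDomain (d + ·) - w n) g| ≤ ρ d + ε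

variable {U : G → H →ₗᵢ[ℂ] H} (hU : ∀ g h x, U (g + h) x = U g (U h x))
include hU

theorem norm_commutator_le_of_tendsto_frameOperator [CompleteSpace H] {w : ℕ → G →₀ ℝ} {W : ℝ}
    {ρ : G → ℝ} (hw : IsAlmostInvariant w W ρ) (f : H) {l : Filter ℕ} [l.NeBot] (hl : l ≤ atTop)
    {K : H →L[ℂ] H}
    (hK : Tendsto (fun n => ofCLM (frameOperator (U · f) (w n))) l (𝓝 (ofCLM K))) (d : G) :
    ‖(U d).toContinuousLinearMap ∘L K - K ∘L (U d).toContinuousLinearMap‖ ≤ ρ d * ‖f‖ ^ 2 := by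
  let V := (U d).toContinuousLinearMap
  have hcomm : Tendsto (fun n => ofCLM (V ∘L frameOperator (U · f) (w n) -
      frameOperator (U · f) (w n) ∘L V)) l (𝓝 (ofCLM (V ∘L K - K ∘L V))) :=
    (((ContinuousLinearMapWOT.continuous_postcomp (ofCLM V)).tendsto _).comp hK).sub
      (((ContinuousLinearMapWOT.continuous_precomp (ofCLM V)).tendsto _).comp hK)
  have hbound (ε : ℝ) (hε : 0 < ε) : ‖V ∘L K - K ∘L V‖ ≤ (ρ d + ε) * ‖f‖ ^ 2 := by
    have hn := hl (hw.sum_translate_sub_le d ε hε)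
    refine norm_le_of_tendsto_wot hcomm (Eventually.mono hn fun n hn => ?_)
    refine (norm_commutator_frameOperator_le (σ := (d + ·)) (M := ‖f‖)
      (fun g => ((U g).norm_map f).le) (U d) (fun g => (hU d g f).symm) (w n)).trans ?_
    gcongr
  have hcont : Continuous fun ε : ℝ => (ρ d + ε) * ‖f‖ ^ 2 := by fun_prop
  refine ge_of_tendsto (x := 𝓝[>] (0 : ℝ)) ?_ (eventually_mem_nhdsWithin.mono hbound)
  simpa only [add_zero] using (hcont.tendsto 0).mono_left nhdsWithin_le_nhds

theorem totallyBounded_orbit_of_norm_commutator_le {K : H →L[ℂ] H} (hK : IsCompactOperator K)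
    {ρ : G → ℝ} {C : ℝ} (hC : 0 ≤ C)
    (hcomm : ∀ d, ‖(U d).toContinuousLinearMap ∘L K - K ∘L (U d).toContinuousLinearMap‖ ≤ ρ d * C)
    {S : Set G} (hS : ∀ δ > 0, ∃ F : Finset G, S ⊆ (F : Set G) + {d | ρ d < δ}) (x : H) :
    TotallyBounded ((fun g => U g (K x)) '' S) := by
  refine totallyBounded_of_subset_thickening fun ε hε => ?_
  obtain ⟨δ, hδ, hδε⟩ := exists_pos_mul_lt hε (C * ‖x‖)
  obtain ⟨F, hF⟩ := hS δ hδ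
  have hball : TotallyBounded (K '' Metric.closedBall 0 ‖x‖) :=
    (hK.isCompact_closure_image_closedBall ‖x‖).totallyBounded.subset subset_closure
  refine ⟨⋃ h ∈ F, U h '' (K '' Metric.closedBall 0 ‖x‖),
    (totallyBounded_biUnion F.finite_toSet).2 fun h _ =>
      hball.image (U h).isometry.uniformContinuous, ?_⟩
  rintro _ ⟨g, hg, rfl⟩
  obtain ⟨h, hh, d, hd, rfl⟩ := hF hg
  refine Metric.mem_thickening_iff.2 ⟨U h (K (U d x)), Set.mem_biUnion hh
    ⟨_, ⟨U d x, mem_closedBall_zero_iff.2 ((U d).norm_map x).le, rfl⟩, rfl⟩, ?_⟩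
  calc dist (U (h + d) (K x)) (U h (K (U d x)))
      = ‖((U d).toContinuousLinearMap ∘L K - K ∘L (U d).toContinuousLinearMap) x‖ := by
        rw [hU, (U h).dist_map, dist_eq_norm]
        rfl
    _ ≤ ρ d * C * ‖x‖ := ContinuousLinearMap.le_of_opNorm_le _ (hcomm d) x
    _ ≤ δ * C * ‖x‖ := by
      gcongr
      exact hd.le
    _ < ε := by rwa [mul_assoc, mul_comm]

theorem tendsto_sum_weight_mul_norm_inner_sq [CompleteSpace H] {w : ℕ → G →₀ ℝ} {W : ℝ}
    {ρ : G → ℝ} (hw : IsAlmostInvariant w W ρ) {S : Set G}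
    (hS : ∀ δ > 0, ∃ F : Finset G, S ⊆ (F : Set G) + {d | ρ d < δ}) {f : H}
    (hf : ∀ x, TotallyBounded ((fun g => U g x) '' S) → inner ℂ x f = 0) :
    Tendsto (fun n => ∑ g ∈ (w n).support, w n g * ‖inner ℂ (U g f) f‖ ^ 2) atTop (𝓝 0) := by
  simp_rw [← reApplyInnerSelf_frameOperator (U · f)]
  refine (tendsto_iff_ultrafilter _ _ _).2 fun 𝒰 h𝒰 => ?_
  obtain ⟨K, hKcomp, hK⟩ := exists_isCompactOperator_tendsto_frameOperator
    (fun g => ((U g).norm_map f).le) 𝒰 hw.nonneg hw.sum_le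
  have horbit := totallyBounded_orbit_of_norm_commutator_le hU hKcomp (sq_nonneg ‖f‖)
    (norm_commutator_le_of_tendsto_frameOperator hU hw f h𝒰 hK) hS f
  have hzero : K.reApplyInnerSelf f = 0 := by
    rw [K.reApplyInnerSelf_apply, hf _ horbit, map_zero]
  exact hzero ▸ tendsto_reApplyInnerSelf_of_tendsto_wot hK f

theorem inner_apply_apply_eq_inner_sub_apply (g h : G) (f : H) :
    inner ℂ (U g f) (U h f) = inner ℂ (U (g - h) f) f := by
  rw [← (U h).inner_map_map (U (g - h) f) f, ← hU, add_sub_cancel]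

theorem norm_sum_sq_le (s : Finset G) (f : H) :
    ‖∑ g ∈ s, U g f‖ ^ 2 ≤ ∑ p ∈ s ×ˢ s, ‖inner ℂ (U (p.1 - p.2) f) f‖ := by
  rw [← inner_self_eq_norm_sq (𝕜 := ℂ), inner_self_re_eq_norm, sum_inner, Finset.sum_product]
  refine norm_sum_le_of_le _ fun g _ => ?_
  rw [inner_sum]
  exact norm_sum_le_of_le _ fun h _ => by rw [inner_apply_apply_eq_inner_sub_apply hU]

theorem norm_sum_pow_four_le (s : Finset G) {w : G →₀ ℝ} (hw : 0 ≤ w) {δ : ℝ}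
    (hδ0 : 0 ≤ δ) (hδ : ∀ g ∈ s, ∀ h ∈ s, δ ≤ w (g - h)) (f : H) :
    δ * ‖∑ g ∈ s, U g f‖ ^ 4 ≤
      (s.card : ℝ) ^ 3 * ∑ k ∈ w.support, w k * ‖inner ℂ (U k f) f‖ ^ 2 := by
  let c : G → ℝ := fun k => ‖inner ℂ (U k f) f‖
  calc δ * ‖∑ g ∈ s, U g f‖ ^ 4 = δ * (‖∑ g ∈ s, U g f‖ ^ 2) ^ 2 := by ring
    _ ≤ δ * (∑ p ∈ s ×ˢ s, c (p.1 - p.2)) ^ 2 := by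
      gcongr
      exact norm_sum_sq_le hU s f
    _ ≤ δ * ((s ×ˢ s).card * ∑ p ∈ s ×ˢ s, c (p.1 - p.2) ^ 2) := by
      gcongr
      exact sq_sum_le_card_mul_sum_sq
    _ = (s.card : ℝ) ^ 2 * (δ * ∑ p ∈ s ×ˢ s, c (p.1 - p.2) ^ 2) := by
      rw [Finset.card_product]
      push_cast
      ring
    _ ≤ (s.card : ℝ) ^ 2 * (s.card * ∑ k ∈ w.support, w k * c k ^ 2) :=
      mul_le_mul_of_nonneg_left
        (mul_sum_sub_le_card_mul_sum s hw hδ (c := fun k => c k ^ 2) fun k => sq_nonneg (c k))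
        (sq_nonneg _)
    _ = (s.card : ℝ) ^ 3 * ∑ k ∈ w.support, w k * c k ^ 2 := by ring

theorem tendsto_norm_average_of_forall_inner_eq_zero [CompleteSpace H] {w : ℕ → G →₀ ℝ} {W : ℝ}
    {ρ : G → ℝ} (hw : IsAlmostInvariant w W ρ) {S : Set G}
    (hS : ∀ δ > 0, ∃ F : Finset G, S ⊆ (F : Set G) + {d | ρ d < δ}) {f : H}
    (hf : ∀ x, TotallyBounded ((fun g => U g x) '' S) → inner ℂ x f = 0)
    {q : ℕ → G} (hq : Function.Injective q) {n : ℕ → ℕ} (hn : Tendsto n atTop atTop)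
    {κ : ℝ} (hκ : 0 < κ) (hqw : ∀ N, ∀ i < N, ∀ j < N, κ / N ≤ w (n N) (q i - q j)) :
    Tendsto (fun N : ℕ => ‖(1 / (N : ℂ)) • ∑ i ∈ Finset.range N, U (q i) f‖) atTop (𝓝 0) := by
  classical
  let Q : ℕ → ℝ := fun m => ∑ g ∈ (w m).support, w m g * ‖inner ℂ (U g f) f‖ ^ 2
  have hQ : Tendsto Q atTop (𝓝 0) := tendsto_sum_weight_mul_norm_inner_sq hU hw hS hf
  have hlim : Tendsto (fun N => √√(Q (n N) / κ)) atTop (𝓝 0) := by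
    simpa only [zero_div, Real.sqrt_zero, Function.comp_apply] using
      ((hQ.comp hn).div_const κ).sqrt.sqrt
  have hsum (N : ℕ) : κ / N * ‖∑ i ∈ Finset.range N, U (q i) f‖ ^ 4 ≤ (N : ℝ) ^ 3 * Q (n N) := by
    have h := norm_sum_pow_four_le hU ((Finset.range N).image q) (hw.nonneg (n N))
      (δ := κ / N) (by positivity) (by
        simpa only [Finset.forall_mem_image, Finset.mem_range] using hqw N) f
    rwa [Finset.card_image_of_injective _ hq, Finset.card_range,
      Finset.sum_image hq.injOn] at h
  refine squeeze_zero' (Eventually.of_forall fun N => norm_nonneg _) ?_ hlim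
  filter_upwards [eventually_gt_atTop 0] with N hN
  refine Real.le_sqrt_of_sq_le (Real.le_sqrt_of_sq_le ?_)
  rw [norm_smul, norm_div, norm_one, Complex.norm_natCast, le_div_iff₀ hκ]
  calc ((1 / N * ‖∑ i ∈ Finset.range N, U (q i) f‖) ^ 2) ^ 2 * κ
      = (1 / (N : ℝ)) ^ 3 * (κ / N * ‖∑ i ∈ Finset.range N, U (q i) f‖ ^ 4) := by ring
    _ ≤ (1 / (N : ℝ)) ^ 3 * (N ^ 3 * Q (n N)) :=
      mul_le_mul_of_nonneg_left (hsum N) (by positivity)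
    _ = Q (n N) := by field_simp

end Representations

section Lattice

open scoped Pointwise

/-- The signed vertical distance of a lattice point from the line of slope `β`. -/
noncomputable def height (β : ℝ) : ℤ × ℤ →+ ℝ where
  toFun g := g.2 - β * g.1
  map_zero' := by simp
  map_add' g h := by push_cast [Prod.fst_add, Prod.snd_add]; ring

theorem height_apply (β : ℝ) (g : ℤ × ℤ) : height β g = g.2 - β * g.1 := rfl

theorem mem_strip_iff {β b : ℝ} {g : ℤ × ℤ} : g ∈ strip β b ↔ |height β g| ≤ b / 2 := by
  rw [strip, Set.mem_ofPred_eq, height_apply, abs_le]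
  constructor <;> rintro ⟨h1, h2⟩ <;> constructor <;> linarith

theorem strip_mono (β : ℝ) {b c : ℝ} (h : b ≤ c) : strip β b ⊆ strip β c := fun g hg =>
  mem_strip_iff.2 ((mem_strip_iff.1 hg).trans (by gcongr))

theorem sub_mem_strip {β b c : ℝ} {g h : ℤ × ℤ} (hg : g ∈ strip β b) (hh : h ∈ strip β c) :
    g - h ∈ strip β (b + c) := by
  rw [mem_strip_iff] at *
  rw [map_sub]
  linarith [abs_sub (height β g) (height β h)]

theorem exists_finset_strip_subset_add_strip (β c : ℝ) {b : ℝ} (hb : 0 < b) :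
    ∃ F : Finset (ℤ × ℤ), strip β c ⊆ (F : Set (ℤ × ℤ)) + strip β b := by
  have hheight : TotallyBounded (height β '' strip β c) := by
    refine (totallyBounded_Icc (-(c / 2)) (c / 2)).subset ?_
    rintro _ ⟨g, hg, rfl⟩
    exact abs_le.1 (mem_strip_iff.1 hg)
  obtain ⟨F, -, hF⟩ := exists_finset_dist_lt_of_totallyBounded_image hheight (half_pos hb)
  refine ⟨F, fun g hg => ?_⟩
  obtain ⟨h, hh, hgh⟩ := hF g hg
  refine ⟨h, hh, g - h, mem_strip_iff.2 ?_, add_sub_cancel h g⟩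
  rw [map_sub]
  exact hgh.le

/-- A finite set of lattice points containing all those with first coordinate at most `L` and
height at most `R` in absolute value: the rectangle `[-L, L] × [-R, R]` sheared along the line of
slope `β`. -/
noncomputable def box (β : ℝ) (R L : ℕ) : Finset (ℤ × ℤ) :=
  (Finset.Icc (-L : ℤ) L ×ˢ Finset.Icc (-R : ℤ) R).image fun p => (p.1, round (β * p.1) + p.2)

theorem mem_box_of_abs_le {β : ℝ} {R L : ℕ} {g : ℤ × ℤ} (hL : |g.1| ≤ L)
    (hR : |height β g| ≤ R) : g ∈ box β R L := by
  have hround : |((g.2 - round (β * g.1) : ℤ) : ℝ)| < R + 1 := by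
    have h := abs_le.1 (abs_sub_round (β * g.1))
    rw [height_apply, abs_le] at hR
    push_cast
    rw [abs_lt]
    constructor <;> linarith [hR.1, hR.2, h.1, h.2]
  refine Finset.mem_image.2 ⟨(g.1, g.2 - round (β * g.1)), Finset.mem_product.2
    ⟨Finset.mem_Icc.2 (abs_le.1 hL), Finset.mem_Icc.2 (abs_le.1 (Int.lt_add_one_iff.1 ?_))⟩, ?_⟩
  · exact_mod_cast hround
  · rw [add_sub_cancel]

theorem card_box_le (β : ℝ) (R L : ℕ) : (box β R L).card ≤ (2 * L + 1) * (2 * R + 1) := by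
  refine Finset.card_image_le.trans (le_of_eq ?_)
  rw [Finset.card_product, Int.card_Icc, Int.card_Icc]
  congr 1 <;> omega

theorem strip_inter_slab_subset_box (β b : ℝ) (k : ℕ) :
    strip β b ∩ slab k ⊆ box β ⌈b / 2⌉₊ k := fun g ⟨hg, h0, hk⟩ =>
  mem_box_of_abs_le (abs_le.2 ⟨by omega, by omega⟩) ((mem_strip_iff.1 hg).trans (Nat.le_ceil _))

theorem finite_strip_inter_slab (β b : ℝ) (k : ℕ) : (strip β b ∩ slab k).Finite :=
  (Finset.finite_toSet _).subset (strip_inter_slab_subset_box β b k)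

theorem ncard_strip_inter_slab_le (β b : ℝ) (k : ℕ) :
    (strip β b ∩ slab k).ncard ≤ (2 * k + 1) * (2 * ⌈b / 2⌉₊ + 1) := by
  refine le_trans ?_ (card_box_le β _ k)
  rw [← Set.ncard_coe_finset]
  exact Set.ncard_le_ncard (strip_inter_slab_subset_box β b k)

theorem ncard_inter_slab_le {β b : ℝ} {Q : Set (ℤ × ℤ)} (hQ : Q ⊆ strip β b) (k : ℕ) :
    (Q ∩ slab k).ncard ≤ (strip β b ∩ slab k).ncard :=
  Set.ncard_le_ncard (Set.inter_subset_inter_left _ hQ) (finite_strip_inter_slab β b k)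

theorem round_mem_strip (β : ℝ) (m : ℤ) : (m, round (β * m)) ∈ strip β 1 := by
  rw [mem_strip_iff, height_apply, abs_sub_comm]
  exact abs_sub_round _

/-- `Q` meets the slab `[0, k - 1] × ℤ` in a number of points that grows at least linearly
in `k`. -/
def HasLinearGrowth (Q : Set (ℤ × ℤ)) : Prop :=
  ∃ δ : ℝ, 0 < δ ∧ ∀ᶠ k : ℕ in atTop, δ * k ≤ (Q ∩ slab k).ncard

theorem hasLinearGrowth_of_strip_subset_add {β b : ℝ} {Q : Set (ℤ × ℤ)} (hQ : Q ⊆ strip β b)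
    {F : Finset (ℤ × ℤ)} (hF : strip β 1 ⊆ (F : Set (ℤ × ℤ)) + Q) : HasLinearGrowth Q := by
  have hfin (k : ℕ) : (Q ∩ slab k).Finite :=
    (finite_strip_inter_slab β b k).subset (Set.inter_subset_inter_left _ hQ)
  obtain ⟨M, hM⟩ : ∃ M : ℕ, ∀ p ∈ F, p.1.natAbs ≤ M :=
    ⟨F.sup fun p => p.1.natAbs, fun p hp => Finset.le_sup (f := fun p => p.1.natAbs) hp⟩
  choose p hpF r hrQ hpr using fun m : ℤ => hF (round_mem_strip β m)
  have hfst (m : ℤ) : (p m).1 + (r m).1 = m := congrArg Prod.fst (hpr m)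
  refine ⟨1 / (2 * (F.card + 1)), by positivity, ?_⟩
  filter_upwards [eventually_ge_atTop (4 * M)] with k hk
  have hcard : (Finset.Ico (M : ℤ) (k - M)).card ≤ (F ×ˢ (hfin k).toFinset).card := by
    refine Finset.card_le_card_of_injOn (fun m => (p m, r m)) (fun m hm => ?_)
      fun m _ m' _ h => ?_
    · have hMm := hM _ (hpF m)
      have hm' := Finset.mem_Ico.1 hm
      have := hfst m
      have hslab : r m ∈ slab k := ⟨by omega, by omega⟩
      exact Finset.mem_product.2 ⟨hpF m, (hfin k).mem_toFinset.2 ⟨hrQ m, hslab⟩⟩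
    · obtain ⟨hp, hr⟩ := Prod.mk.inj h
      rw [← hfst m, ← hfst m', hp, hr]
  rw [Finset.card_product, Int.card_Ico, ← Set.ncard_eq_toFinset_card _ (hfin k)] at hcard
  have hk2 : k ≤ 2 * (F.card * (Q ∩ slab k).ncard) := by omega
  have hk2' : (k : ℝ) ≤ 2 * (F.card * (Q ∩ slab k).ncard) := by exact_mod_cast hk2
  rw [one_div_mul_eq_div, div_le_iff₀ (by positivity)]
  nlinarith [Nat.cast_nonneg (α := ℝ) (Q ∩ slab k).ncard]

theorem hasLinearGrowth_strip (β : ℝ) {b : ℝ} (hb : 0 < b) : HasLinearGrowth (strip β b) :=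
  (exists_finset_strip_subset_add_strip β 1 hb).elim fun _ =>
    hasLinearGrowth_of_strip_subset_add subset_rfl

theorem HasLinearGrowth.infinite {Q : Set (ℤ × ℤ)} (hQ : HasLinearGrowth Q) : Q.Infinite := by
  obtain ⟨δ, hδ, hgrow⟩ := hQ
  intro hfin
  obtain ⟨k, hk, hlt⟩ := (hgrow.and ((tendsto_natCast_atTop_atTop.const_mul_atTop
    hδ).eventually_gt_atTop (Q.ncard : ℝ))).exists
  exact (hk.trans (Nat.cast_le.2 (Set.ncard_le_ncard Set.inter_subset_left hfin))).not_gt hlt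

theorem HasLinearGrowth.lowerRelDensity_pos {β b : ℝ} {Q : Set (ℤ × ℤ)} (hQ : HasLinearGrowth Q)
    (hQb : Q ⊆ strip β b) : 0 < lowerRelDensity β b Q := by
  obtain ⟨δ, hδ, hgrow⟩ := hQ
  let C : ℝ := 3 * (2 * ⌈b / 2⌉₊ + 1)
  have hC : 0 < C := by positivity
  refine (div_pos hδ hC).trans_le (le_liminf_of_le ?_ ?_)
  · refine IsBoundedUnder.isCoboundedUnder_ge (isBoundedUnder_of ⟨1, fun k => ?_⟩)
    exact div_le_one_of_le₀ (Nat.cast_le.2 (ncard_inter_slab_le hQb k)) (Nat.cast_nonneg _)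
  · filter_upwards [hgrow, eventually_gt_atTop 0] with k hk hk0
    have hk1 : (1 : ℝ) ≤ k := Nat.one_le_cast.2 hk0
    have hQk : ((Q ∩ slab k).ncard : ℝ) ≤ (strip β b ∩ slab k).ncard :=
      Nat.cast_le.2 (ncard_inter_slab_le hQb k)
    have hstrip : ((strip β b ∩ slab k).ncard : ℝ) ≤ C * k := by
      calc ((strip β b ∩ slab k).ncard : ℝ) ≤ (2 * k + 1) * (2 * ⌈b / 2⌉₊ + 1) := by
            exact_mod_cast ncard_strip_inter_slab_le β b k
        _ ≤ (3 * k) * (2 * ⌈b / 2⌉₊ + 1) := by gcongr; linarith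
        _ = C * k := by ring
    rw [div_le_div_iff₀ hC (by linarith [mul_pos hδ (zero_lt_one.trans_le hk1)])]
    calc δ * (strip β b ∩ slab k).ncard ≤ δ * (C * k) := by gcongr
      _ = δ * k * C := by ring
      _ ≤ (Q ∩ slab k).ncard * C := by gcongr

theorem hasLinearGrowth_of_lowerRelDensity_pos {β b : ℝ} (hb : 0 < b) {Q : Set (ℤ × ℤ)}
    (hQ : 0 < lowerRelDensity β b Q) : HasLinearGrowth Q := by
  obtain ⟨θ, hθ, hlt⟩ := exists_between hQ
  obtain ⟨δ, hδ, hgrow⟩ := hasLinearGrowth_strip β hb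
  refine ⟨θ * δ, mul_pos hθ hδ, ?_⟩
  filter_upwards [hgrow, eventually_gt_atTop 0, eventually_lt_of_lt_liminf hlt
    (isBoundedUnder_of ⟨0, fun k => by positivity⟩)] with k hstrip hk hratio
  have hpos : (0 : ℝ) < (strip β b ∩ slab k).ncard :=
    (mul_pos hδ (Nat.cast_pos.2 hk)).trans_le hstrip
  calc θ * δ * k = θ * (δ * k) := mul_assoc ..
    _ ≤ θ * (strip β b ∩ slab k).ncard := by gcongr
    _ ≤ (Q ∩ slab k).ncard := ((lt_div_iff₀ hpos).1 hratio).le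

theorem IsOrderedEnumeration.ncard_inter_slab_le {Q : Set (ℤ × ℤ)} {q : ℕ → ℤ × ℤ}
    (hq : IsOrderedEnumeration Q q) (i : ℕ) : (Q ∩ slab (q i).1.natAbs).ncard ≤ i := by
  have hsub : Q ∩ slab (q i).1.natAbs ⊆ (Finset.range i).image q := by
    rw [← hq.range_eq]
    rintro _ ⟨⟨j, rfl⟩, h0, hj⟩
    refine Finset.mem_coe.2 (Finset.mem_image_of_mem q (Finset.mem_range.2 ?_))
    by_contra! hij
    have hmono : |(q i).1| ≤ |(q j).1| := hq.monotone_abs hij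
    rw [Int.abs_eq_natAbs, abs_of_nonneg h0] at hmono
    omega
  calc (Q ∩ slab (q i).1.natAbs).ncard ≤ ((Finset.range i).image q).card :=
        (Set.ncard_le_ncard hsub (Finset.finite_toSet _)).trans_eq (Set.ncard_coe_finset _)
    _ ≤ i := Finset.card_image_le.trans_eq (Finset.card_range i)

theorem IsOrderedEnumeration.exists_natAbs_fst_le {Q : Set (ℤ × ℤ)} {q : ℕ → ℤ × ℤ}
    (hq : IsOrderedEnumeration Q q) (hQ : HasLinearGrowth Q) :
    ∃ D : ℕ, ∀ i, (q i).1.natAbs ≤ D * (i + 1) := by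
  obtain ⟨δ, hδ, hgrow⟩ := hQ
  obtain ⟨k₀, hk₀⟩ := eventually_atTop.1 hgrow
  obtain ⟨n, hn⟩ := exists_nat_gt (1 / δ)
  refine ⟨k₀ + n, fun i => ?_⟩
  rcases le_total (q i).1.natAbs k₀ with hlt | hge
  · nlinarith
  · have hi : δ * (q i).1.natAbs ≤ i :=
      (hk₀ _ hge).trans (Nat.cast_le.2 (hq.ncard_inter_slab_le i))
    have hni : ((q i).1.natAbs : ℝ) ≤ n * i := by
      calc ((q i).1.natAbs : ℝ) ≤ i / δ := (le_div_iff₀' hδ).2 hi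
        _ = 1 / δ * i := by ring
        _ ≤ n * i := by gcongr
    have hni' : (q i).1.natAbs ≤ n * i := by exact_mod_cast hni
    nlinarith

theorem exists_isOrderedEnumeration {Q : Set (ℤ × ℤ)} (hinf : Q.Infinite)
    (hinj : Set.InjOn (fun g => g.1.natAbs) Q) : ∃ q, IsOrderedEnumeration Q q := by
  let A : Set ℕ := (fun g : ℤ × ℤ => g.1.natAbs) '' Q
  have hA : A.Infinite := hinf.image hinj
  let σ : ℕ → ℤ × ℤ := Function.invFunOn (fun g => g.1.natAbs) Q
  have hinv : Set.InvOn σ (fun g => g.1.natAbs) Q A := hinj.bijOn_image.invOn_invFunOn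
  have hσ : Set.BijOn σ A Q := hinj.bijOn_image.symm hinv.symm
  have hmem (i : ℕ) : Nat.nth (· ∈ A) i ∈ A := Nat.nth_mem_of_infinite hA i
  refine ⟨fun i => σ (Nat.nth (· ∈ A) i), fun i j hij => ?_, ?_, fun i j hij => ?_⟩
  · exact Nat.nth_injective hA (hσ.injOn (hmem i) (hmem j) hij)
  · have hrange : Set.range (Nat.nth (· ∈ A)) = A := Nat.range_nth_of_infinite hA
    rw [Set.range_comp', hrange, hσ.image_eq]
  · have habs (i : ℕ) : |(σ (Nat.nth (· ∈ A) i)).1| = Nat.nth (· ∈ A) i := by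
      rw [Int.abs_eq_natAbs]
      exact congrArg Nat.cast (hinv.2 (hmem i))
    simp only [habs]
    exact Nat.cast_le.2 (Nat.nth_monotone hA hij)

end Lattice

section TentWeight

open scoped Pointwise

variable (β : ℝ) (R N : ℕ)

/-- The Følner-type weight on `ℤ × ℤ` used to average over a strip: a tent of height `R / N` over
the points of height at most `R` and first coordinate at most `R * N` in absolute value. It decays
slowly in both directions, so that translation by `d` costs only `O(|height β d|)` in `ℓ¹`. It is
zero when `N = 0`. -/
noncomputable def tentWeight : ℤ × ℤ →₀ ℝ :=
  Finsupp.onFinset (box β R (R * N))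
    (fun g => max 0 (R - |height β g| - |(g.1 : ℝ)| / N) / N) fun g hg => by
      obtain ⟨hmax, hN⟩ := div_ne_zero_iff.1 hg
      have hN' : (0 : ℝ) < N := (Nat.cast_nonneg N).lt_of_ne' hN
      have hpos : 0 < R - |height β g| - |(g.1 : ℝ)| / N := by
        by_contra! hle
        exact hmax (max_eq_left hle)
      refine mem_box_of_abs_le ?_ (by linarith [div_nonneg (abs_nonneg (g.1 : ℝ)) hN'.le])
      have hfst : |(g.1 : ℝ)| ≤ R * N := by
        rw [← div_le_iff₀ hN']
        linarith [abs_nonneg (height β g)]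
      exact_mod_cast hfst

theorem tentWeight_apply (g : ℤ × ℤ) :
    tentWeight β R N g = max 0 (R - |height β g| - |(g.1 : ℝ)| / N) / N := rfl

theorem support_tentWeight_subset : (tentWeight β R N).support ⊆ box β R (R * N) :=
  Finsupp.support_onFinset_subset

theorem tentWeight_nonneg : 0 ≤ tentWeight β R N := fun g => by
  rw [tentWeight_apply]
  exact div_nonneg (le_max_left _ _) (Nat.cast_nonneg N)

theorem tentWeight_le (g : ℤ × ℤ) : tentWeight β R N g ≤ R / N := by
  rw [tentWeight_apply]
  gcongr
  refine max_le (Nat.cast_nonneg R) ?_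
  linarith [abs_nonneg (height β g), div_nonneg (abs_nonneg (g.1 : ℝ)) (Nat.cast_nonneg N)]

theorem abs_tentWeight_sub_sub_le (g d : ℤ × ℤ) :
    |tentWeight β R N (g - d) - tentWeight β R N g| ≤
      (|height β d| + |(d.1 : ℝ)| / N) / N := by
  have hheight : |(|height β g| - |height β (g - d)|)| ≤ |height β d| :=
    (abs_abs_sub_abs_le _ _).trans_eq (by rw [map_sub, sub_sub_cancel])
  have hfst : |(|(g.1 : ℝ)| - |((g - d).1 : ℝ)|)| ≤ |(d.1 : ℝ)| :=
    (abs_abs_sub_abs_le _ _).trans_eq (by rw [Prod.fst_sub, Int.cast_sub, sub_sub_cancel])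
  rw [tentWeight_apply, tentWeight_apply, ← sub_div, abs_div, Nat.abs_cast]
  gcongr
  calc _ ≤ |(R - |height β (g - d)| - |((g - d).1 : ℝ)| / N) -
        (R - |height β g| - |(g.1 : ℝ)| / N)| := by
        rw [max_comm 0, max_comm 0]
        exact abs_max_sub_max_le_abs _ _ 0
    _ = |(|height β g| - |height β (g - d)|) + (|(g.1 : ℝ)| - |((g - d).1 : ℝ)|) / N| := by
      congr 1
      ring
    _ ≤ |height β d| + |(d.1 : ℝ)| / N := by
      refine (abs_add_le _ _).trans ?_
      rw [abs_div, Nat.abs_cast]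
      gcongr

variable {β R N}

theorem one_div_le_tentWeight {b : ℝ} (hR : b + 2 ≤ R) {g : ℤ × ℤ} (hg : |height β g| ≤ b)
    (hN : |g.1| ≤ N) : 1 / (N : ℝ) ≤ tentWeight β R N g := by
  have hfst : |(g.1 : ℝ)| / N ≤ 1 :=
    div_le_one_of_le₀ (by exact_mod_cast hN) (Nat.cast_nonneg N)
  rw [tentWeight_apply]
  gcongr
  exact le_max_of_le_right (by linarith)

variable (β R N)

theorem card_box_mul_div_le {C : ℝ} (hC : 0 ≤ C) :
    (box β R (R * N)).card * (C / N) ≤ (2 * R + 1) ^ 2 * C := by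
  rcases N.eq_zero_or_pos with rfl | hN
  · simp only [Nat.cast_zero, div_zero, mul_zero]
    positivity
  · have hN1 : (1 : ℝ) ≤ N := Nat.one_le_cast.2 hN
    have hcard : ((box β R (R * N)).card : ℝ) ≤ (2 * R + 1) ^ 2 * N := by
      calc ((box β R (R * N)).card : ℝ) ≤ (2 * (R * N) + 1) * (2 * R + 1) := by
            exact_mod_cast card_box_le β R (R * N)
        _ ≤ (2 * (R * N) + N) * (2 * R + 1) := by gcongr
        _ = (2 * R + 1) ^ 2 * N := by ring
    calc (box β R (R * N)).card * (C / N) ≤ (2 * R + 1) ^ 2 * N * (C / N) := by gcongr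
      _ = (2 * R + 1) ^ 2 * C := by field_simp

theorem sum_abs_tentWeight_le :
    ∑ g ∈ (tentWeight β R N).support, |tentWeight β R N g| ≤ (2 * R + 1) ^ 2 * R := by
  have hle (g : ℤ × ℤ) : |tentWeight β R N g| ≤ R / N := by
    rw [abs_of_nonneg (tentWeight_nonneg β R N g)]
    exact tentWeight_le β R N g
  calc ∑ g ∈ (tentWeight β R N).support, |tentWeight β R N g|
      ≤ ∑ g ∈ box β R (R * N), |tentWeight β R N g| :=
        Finset.sum_le_sum_of_subset_of_nonneg (support_tentWeight_subset β R N)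
          fun _ _ _ => abs_nonneg _
    _ ≤ (box β R (R * N)).card * (R / N) := by
      rw [← nsmul_eq_mul]
      exact Finset.sum_le_card_nsmul _ _ _ fun g _ => hle g
    _ ≤ (2 * R + 1) ^ 2 * R := card_box_mul_div_le β R N (Nat.cast_nonneg R)

theorem sum_abs_translate_tentWeight_sub_le (d : ℤ × ℤ) :
    ∑ g ∈ ((tentWeight β R N).mapDomain (d + ·) - tentWeight β R N).support,
      |((tentWeight β R N).mapDomain (d + ·) - tentWeight β R N) g| ≤
      2 * (2 * R + 1) ^ 2 * (|height β d| + |(d.1 : ℝ)| / N) := by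
  classical
  let Δ := (tentWeight β R N).mapDomain (d + ·) - tentWeight β R N
  let C : ℝ := |height β d| + |(d.1 : ℝ)| / N
  have hC : 0 ≤ C := by positivity
  have hpoint (g : ℤ × ℤ) : |Δ g| ≤ C / N := by
    have htranslate : (tentWeight β R N).mapDomain (d + ·) g = tentWeight β R N (g - d) := by
      conv_lhs => rw [← add_sub_cancel d g]
      exact Finsupp.mapDomain_apply (add_right_injective d) _ _
    rw [Finsupp.sub_apply, htranslate]
    exact abs_tentWeight_sub_sub_le β R N g d
  have hcard : Δ.support.card ≤ 2 * (box β R (R * N)).card := by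
    have hsupp := Finset.card_le_card (support_tentWeight_subset β R N)
    have htranslate := (Finset.card_le_card (Finsupp.mapDomain_support (f := (d + ·))
      (s := tentWeight β R N))).trans Finset.card_image_le
    have hunion : Δ.support.card ≤ _ :=
      (Finset.card_le_card Finsupp.support_sub).trans (Finset.card_union_le _ _)
    omega
  calc ∑ g ∈ Δ.support, |Δ g| ≤ Δ.support.card * (C / N) := by
        rw [← nsmul_eq_mul]
        exact Finset.sum_le_card_nsmul _ _ _ fun g _ => hpoint g
    _ ≤ (2 * (box β R (R * N)).card : ℕ) * (C / N) := by gcongr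
    _ ≤ 2 * (2 * R + 1) ^ 2 * C := by
      push_cast
      linarith [card_box_mul_div_le β R N hC]

theorem isAlmostInvariant_tentWeight :
    IsAlmostInvariant (tentWeight β R) ((2 * R + 1) ^ 2 * R)
      fun d => 2 * (2 * R + 1) ^ 2 * |height β d| where
  nonneg := tentWeight_nonneg β R
  sum_le := sum_abs_tentWeight_le β R
  sum_translate_sub_le d ε hε := by
    have hlim : Tendsto (fun N : ℕ => 2 * (2 * (R : ℝ) + 1) ^ 2 * (|height β d| + |(d.1 : ℝ)| / N))
        atTop (𝓝 (2 * (2 * R + 1) ^ 2 * (|height β d| + 0))) :=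
      ((tendsto_const_div_atTop_nhds_zero_nat _).const_add _).const_mul _
    rw [add_zero] at hlim
    filter_upwards [hlim.eventually_lt_const (lt_add_of_pos_right _ hε)] with N hN
    exact (sum_abs_translate_tentWeight_sub_le β R N d).trans hN.le

theorem tendsto_norm_average_of_orthogonal_to_totallyBounded_strip_orbits {H : Type*}
    [NormedAddCommGroup H] [InnerProductSpace ℂ H] [CompleteSpace H] {U : ℤ × ℤ → H →ₗᵢ[ℂ] H}
    (hU : ∀ g h x, U (g + h) x = U g (U h x)) {b c : ℝ} {f : H}
    (hf : ∀ x, TotallyBounded ((fun g => U g x) '' strip β c) → inner ℂ x f = 0)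
    {Q : Set (ℤ × ℤ)} (hQ : Q ⊆ strip β b) (hgrow : HasLinearGrowth Q) {q : ℕ → ℤ × ℤ}
    (hq : IsOrderedEnumeration Q q) :
    Tendsto (fun N : ℕ => ‖(1 / (N : ℂ)) • ∑ i ∈ Finset.range N, U (q i) f‖) atTop (𝓝 0) := by
  obtain ⟨D, hD⟩ := hq.exists_natAbs_fst_le hgrow
  obtain ⟨R, hR⟩ := exists_nat_ge (b + 2)
  have hnet (δ : ℝ) (hδ : 0 < δ) : ∃ F : Finset (ℤ × ℤ),
      strip β c ⊆ (F : Set (ℤ × ℤ)) + {d | 2 * (2 * (R : ℝ) + 1) ^ 2 * |height β d| < δ} := by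
    obtain ⟨b', hb', hlt⟩ := exists_pos_mul_lt hδ (2 * (2 * (R : ℝ) + 1) ^ 2)
    obtain ⟨F, hF⟩ := exists_finset_strip_subset_add_strip β c hb'
    refine ⟨F, hF.trans (Set.add_subset_add_left fun d hd => hlt.trans_le' ?_)⟩
    gcongr
    linarith [mem_strip_iff.1 hd]
  have hmem (i : ℕ) : q i ∈ strip β b := hQ (hq.range_eq ▸ Set.mem_range_self i)
  refine tendsto_norm_average_of_forall_inner_eq_zero hU (isAlmostInvariant_tentWeight β R) hnet hf
    hq.injective (n := fun N => (2 * D + 1) * N) (κ := 1 / (2 * D + 1))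
    (tendsto_id.const_mul_atTop' (by positivity)) (by positivity) fun N i hi j hj => ?_
  have hdiff : |(q i - q j).1| ≤ ((2 * D + 1) * N : ℕ) := by
    have hi' : (q i).1.natAbs ≤ D * N := (hD i).trans (by gcongr; exact hi)
    have hj' : (q j).1.natAbs ≤ D * N := (hD j).trans (by gcongr; exact hj)
    rw [Prod.fst_sub]
    grind
  have hheight := mem_strip_iff.1 (sub_mem_strip (hmem i) (hmem j))
  rw [add_self_div_two] at hheight
  calc 1 / (2 * D + 1) / (N : ℝ) = 1 / ((2 * D + 1) * N : ℕ) := by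
        push_cast
        rw [div_div]
    _ ≤ _ := one_div_le_tentWeight hR hheight hdiff

end TentWeight

section SuperlevelSets

open scoped symmDiff

theorem symmDiff_superlevel_subset {X : Type*} (φ ψ : X → ℝ) (a η : ℝ) :
    {x | a < φ x} ∆ {x | a < ψ x} ⊆ {x | dist (ψ x) a ≤ η} ∪ {x | η ≤ dist (φ x) (ψ x)} := by
  intro x hx
  by_contra hnot
  obtain ⟨hψ, hφψ⟩ := not_or.1 hnot
  simp only [Set.mem_ofPred_eq, not_le, Real.dist_eq, lt_abs, abs_lt] at hψ hφψ
  rcases hx with ⟨hφ, hψ'⟩ | ⟨hψ', hφ⟩ <;> simp only [Set.mem_ofPred_eq, not_lt] at hφ hψ' <;>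
    rcases hψ with h | h <;> linarith

variable {X : Type*} [MeasurableSpace X] {μ : Measure X}

theorem exists_measure_dist_le_lt {E : Type*} [MetricSpace E] [MeasurableSpace E]
    [BorelSpace E] [IsFiniteMeasure μ] {φ : X → E} (hφ : Measurable φ) {a : E}
    (ha : μ {x | φ x = a} = 0) {ε : ENNReal} (hε : 0 < ε) :
    ∃ η > 0, μ {x | dist (φ x) a ≤ η} < ε := by
  have hlim := tendsto_measure_cthickening_of_isClosed (μ := μ.map φ)
    ⟨1, one_pos, measure_ne_top _ _⟩ (isClosed_singleton (x := a))
  rw [Measure.map_apply hφ (measurableSet_singleton a)] at hlim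
  obtain ⟨η, hlt, hη⟩ := (((hlim.eventually_lt_const (ha.trans_lt hε)).filter_mono
    nhdsWithin_le_nhds).and (self_mem_nhdsWithin (s := Set.Ioi (0 : ℝ)))).exists
  rw [Metric.cthickening_singleton a (le_of_lt hη),
    Measure.map_apply hφ Metric.isClosed_closedBall.measurableSet] at hlt
  exact ⟨η, hη, hlt⟩

theorem tendsto_measure_symmDiff_superlevel [IsFiniteMeasure μ] {ι : Type*} {l : Filter ι}
    {φ : ι → X → ℝ} {ψ : X → ℝ} (hφ : TendstoInMeasure μ φ l ψ) (hψ : Measurable ψ) {a : ℝ}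
    (ha : μ {x | ψ x = a} = 0) :
    Tendsto (fun i => μ ({x | a < φ i x} ∆ {x | a < ψ x})) l (𝓝 0) := by
  refine ENNReal.tendsto_nhds_zero.2 fun ε hε => ?_
  obtain ⟨η, hη, hψη⟩ := exists_measure_dist_le_lt hψ ha (ENNReal.half_pos hε.ne')
  filter_upwards [ENNReal.tendsto_nhds_zero.1 (tendstoInMeasure_iff_dist.1 hφ η hη) (ε / 2)
    (ENNReal.half_pos hε.ne')] with i hi
  calc μ ({x | a < φ i x} ∆ {x | a < ψ x})
      ≤ μ {x | dist (ψ x) a ≤ η} + μ {x | η ≤ dist (φ i x) (ψ x)} :=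
        (measure_mono (symmDiff_superlevel_subset _ _ a η)).trans (measure_union_le _ _)
    _ ≤ ε / 2 + ε / 2 := add_le_add hψη.le hi
    _ = ε := ENNReal.add_halves ε

theorem hasCountableSeparatingOn_image_Ioi {α : Type*} [LinearOrder α] [DenselyOrdered α]
    [TopologicalSpace α] [OrderTopology α] [SecondCountableTopology α] {D : Set α}
    (hD : Dense D) : HasCountableSeparatingOn α (· ∈ Set.Ioi '' D) Set.univ := by
  obtain ⟨C, hCD, hC, hCdense⟩ := hD.exists_countable_dense_subset
  have hle {x y : α} (h : ∀ s ∈ Set.Ioi '' C, x ∈ s ↔ y ∈ s) : x ≤ y := by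
    by_contra! hyx
    obtain ⟨a, ha, hya, hax⟩ := hCdense.exists_between hyx
    exact hya.not_gt ((h _ (Set.mem_image_of_mem _ ha)).1 hax)
  exact ⟨⟨Set.Ioi '' C, hC.image _, Set.image_mono hCD, fun x _ y _ h =>
    (hle h).antisymm (hle fun s hs => (h s hs).symm)⟩⟩

theorem exists_ae_eq_const_of_superlevel [SFinite μ] {φ : X → ℝ} (hφ : Measurable φ)
    (h : ∀ a, μ {x | φ x = a} = 0 →
      {x | a < φ x} =ᵐ[μ] (∅ : Set X) ∨ {x | a < φ x} =ᵐ[μ] (Set.univ : Set X)) :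
    ∃ a, φ =ᵐ[μ] Function.const X a := by
  have hdense : Dense {a | 0 < μ {x | φ x = a}}ᶜ :=
    (Measure.countable_meas_level_set_pos hφ).dense_compl ℝ
  have := hasCountableSeparatingOn_image_Ioi hdense
  refine exists_eventuallyEq_const_of_forall_separating
    (· ∈ Set.Ioi '' {a | 0 < μ {x | φ x = a}}ᶜ) ?_
  rintro _ ⟨a, ha, rfl⟩
  exact (h a (nonpos_iff_eq_zero.1 (not_lt.1 ha))).symm.imp eventuallyEq_univ.1
    eventuallyEq_empty.1

end SuperlevelSets

section Constants

variable {X 𝕜 : Type*} [RCLike 𝕜] [MeasurableSpace X] (μ : Measure X)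

theorem inner_const_left [IsFiniteMeasure μ] (a : 𝕜) (f : Lp 𝕜 2 μ) :
    inner 𝕜 (Lp.const 2 μ a) f = inner 𝕜 a (∫ x, f x ∂μ) := by
  rw [← indicatorConstLp_univ, L2.inner_indicatorConstLp_eq_inner_setIntegral, setIntegral_univ]

theorem integral_sub_const_integral [IsProbabilityMeasure μ] (f : Lp 𝕜 2 μ) :
    ∫ x, (f - Lp.const 2 μ (∫ x, f x ∂μ) : Lp 𝕜 2 μ) x ∂μ = 0 := by
  have hf : Integrable f μ := (Lp.memLp f).integrable one_le_two
  calc ∫ x, (f - Lp.const 2 μ (∫ x, f x ∂μ) : Lp 𝕜 2 μ) x ∂μ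
      = ∫ x, (f x - ∫ y, f y ∂μ) ∂μ :=
        integral_congr_ae ((Lp.coeFn_sub f _).trans ((ae_eq_refl _).sub (Lp.coeFn_const _ _ _)))
    _ = 0 := by
      rw [integral_sub hf (integrable_const _), integral_const, probReal_univ, one_smul, sub_self]

variable {μ}

theorem ae_eq_empty_or_univ_of_indicatorConstLp_eq_const [IsFiniteMeasure μ] {B : Set X}
    (hB : MeasurableSet B) {a : 𝕜}
    (h : indicatorConstLp 2 hB (measure_ne_top μ B) (1 : 𝕜) = Lp.const 2 μ a) :
    B =ᵐ[μ] (∅ : Set X) ∨ B =ᵐ[μ] (Set.univ : Set X) := by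
  have hconst : B.indicator (fun _ => 1) =ᵐ[μ] Function.const X a :=
    indicatorConstLp_coeFn.symm.trans (h ▸ Lp.coeFn_const 2 μ a)
  rcases eq_or_ne a 1 with rfl | ha
  · refine .inr (eventuallyEq_univ.2 (hconst.mono fun x hx => ?_))
    by_contra hxB
    rw [Set.indicator_of_notMem hxB] at hx
    exact zero_ne_one hx
  · refine .inl (eventuallyEq_empty.2 (hconst.mono fun x hx hxB => ?_))
    rw [Set.indicator_of_mem hxB] at hx
    exact ha hx.symm

end Constants

section Koopman

variable {X : Type*} [MeasurableSpace X] [AddAction (ℤ × ℤ) X] [MeasurableConstVAdd (ℤ × ℤ) X]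
  (μ : Measure X) [VAddInvariantMeasure (ℤ × ℤ) X μ]

/-- The Koopman operator as a linear isometry. -/
noncomputable def koopmanIsometry (g : ℤ × ℤ) : Lp ℂ 2 μ →ₗᵢ[ℂ] Lp ℂ 2 μ :=
  Lp.compMeasurePreservingₗᵢ ℂ (fun x : X => g +ᵥ x) (measurePreserving_vadd g μ)

theorem koopmanIsometry_apply (g : ℤ × ℤ) (f : Lp ℂ 2 μ) :
    koopmanIsometry μ g f = koopman μ g f := rfl

theorem coeFn_koopman (g : ℤ × ℤ) (f : Lp ℂ 2 μ) : koopman μ g f =ᵐ[μ] f ∘ (g +ᵥ ·) :=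
  Lp.coeFn_compMeasurePreserving f (measurePreserving_vadd g μ)

theorem koopmanIsometry_add (g h : ℤ × ℤ) (f : Lp ℂ 2 μ) :
    koopmanIsometry μ (g + h) f = koopmanIsometry μ g (koopmanIsometry μ h f) := by
  have hcomp : ((h +ᵥ ·) ∘ (g +ᵥ ·) : X → X) = ((g + h) +ᵥ ·) :=
    funext fun x => by rw [Function.comp_apply, vadd_vadd, add_comm]
  refine Eq.trans ?_ (Lp.compMeasurePreserving_comp_apply f (measurePreserving_vadd h μ)
    (measurePreserving_vadd g μ))
  simp only [koopmanIsometry_apply, koopman, hcomp]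

theorem koopman_sub (g : ℤ × ℤ) (f f' : Lp ℂ 2 μ) :
    koopman μ g (f - f') = koopman μ g f - koopman μ g f' :=
  map_sub (koopmanIsometry μ g) f f'

theorem koopman_const [IsFiniteMeasure μ] (g : ℤ × ℤ) (a : ℂ) :
    koopman μ g (Lp.const 2 μ a) = Lp.const 2 μ a := rfl

theorem dist_koopman_koopman (g h : ℤ × ℤ) (f : Lp ℂ 2 μ) :
    dist (koopman μ g f) (koopman μ h f) = dist (koopman μ (g - h) f) f := by
  simp only [← koopmanIsometry_apply]
  conv_lhs => rw [← add_sub_cancel h g, koopmanIsometry_add, (koopmanIsometry μ h).isometry.dist_eq]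

end Koopman

section KroneckerAlgebra

variable {X : Type*} [MeasurableSpace X] (μ : Measure X)

theorem measurableSet_superlevel (L : ℂ →L[ℝ] ℝ) (a : ℝ) (u : Lp ℂ 2 μ) :
    MeasurableSet {x | a < L (u x)} :=
  measurableSet_lt measurable_const (L.measurable.comp (Lp.stronglyMeasurable u).measurable)

variable [IsFiniteMeasure μ]

/-- The indicator function of `{x | a < L (u x)}` as an element of `L²`; the functional `L` is
meant to be the real or the imaginary part. -/
noncomputable def superlevelIndicator (L : ℂ →L[ℝ] ℝ) (a : ℝ) (u : Lp ℂ 2 μ) : Lp ℂ 2 μ :=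
  indicatorConstLp 2 (measurableSet_superlevel μ L a u) (measure_ne_top μ _) 1

theorem coeFn_superlevelIndicator (L : ℂ →L[ℝ] ℝ) (a : ℝ) (u : Lp ℂ 2 μ) :
    superlevelIndicator μ L a u =ᵐ[μ] {x | a < L (u x)}.indicator fun _ => 1 :=
  indicatorConstLp_coeFn

theorem continuousAt_superlevelIndicator (L : ℂ →L[ℝ] ℝ) {a : ℝ} {u : Lp ℂ 2 μ}
    (ha : μ {x | L (u x) = a} = 0) : ContinuousAt (superlevelIndicator μ L a) u := by
  have hL : TendstoInMeasure μ (fun (v : Lp ℂ 2 μ) x => L (v x)) (𝓝 u) fun x => L (u x) :=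
    (tendstoInMeasure_of_tendsto_Lp ((L.compLpL 2 μ).continuous.tendsto u)).congr
      (fun v => L.coeFn_compLpL v) (L.coeFn_compLpL u)
  exact tendsto_indicatorConstLp_set ENNReal.ofNat_ne_top (tendsto_measure_symmDiff_superlevel hL
    (L.measurable.comp (Lp.stronglyMeasurable u).measurable) ha)

variable [AddAction (ℤ × ℤ) X] [MeasurableConstVAdd (ℤ × ℤ) X] [VAddInvariantMeasure (ℤ × ℤ) X μ]

theorem koopman_superlevelIndicator (L : ℂ →L[ℝ] ℝ) (a : ℝ) (g : ℤ × ℤ) (u : Lp ℂ 2 μ) :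
    koopman μ g (superlevelIndicator μ L a u) = superlevelIndicator μ L a (koopman μ g u) := by
  refine Lp.ext ?_
  filter_upwards [coeFn_koopman μ g (superlevelIndicator μ L a u), coeFn_koopman μ g u,
    (measurePreserving_vadd g μ).quasiMeasurePreserving.ae_eq_comp
      (coeFn_superlevelIndicator μ L a u),
    coeFn_superlevelIndicator μ L a (koopman μ g u)] with x hleft hshift hu hright
  rw [hleft, hright, hu]
  simp only [Function.comp_apply, Set.indicator_apply, Set.mem_ofPred_eq, hshift]

theorem mem_kroneckerAlgebra_iff {β c : ℝ} {B : Set X} :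
    B ∈ kroneckerAlgebra μ β c ↔ ∃ hB : MeasurableSet B, TotallyBounded ((fun g : ℤ × ℤ =>
      koopman μ g (indicatorConstLp 2 hB (measure_ne_top μ B) (1 : ℂ))) '' strip β c) :=
  exists_congr fun _ => ⟨fun h => h.totallyBounded.subset subset_closure,
    fun h => h.closure.isCompact_of_isClosed isClosed_closure⟩

theorem superlevel_mem_kroneckerAlgebra {β c : ℝ} {u : Lp ℂ 2 μ}
    (hu : TotallyBounded ((fun g => koopman μ g u) '' strip β c)) (L : ℂ →L[ℝ] ℝ) {a : ℝ}
    (ha : μ {x | L (u x) = a} = 0) : {x | a < L (u x)} ∈ kroneckerAlgebra μ β c := by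
  refine (mem_kroneckerAlgebra_iff μ).2 ⟨measurableSet_superlevel μ L a u,
    totallyBounded_image_of_dist_control hu fun ε hε => ?_⟩
  obtain ⟨δ, hδ, hδε⟩ := Metric.continuousAt_iff.1 (continuousAt_superlevelIndicator μ L ha) ε hε
  refine ⟨δ, hδ, fun g _ h _ hgh => ?_⟩
  change dist (koopman μ g (superlevelIndicator μ L a u))
    (koopman μ h (superlevelIndicator μ L a u)) < ε
  rw [dist_koopman_koopman] at hgh ⊢
  rw [koopman_superlevelIndicator]
  exact hδε hgh

theorem IsWeakMixing.exists_eq_const_of_totallyBounded {β c : ℝ} (hwm : IsWeakMixing μ β c)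
    {u : Lp ℂ 2 μ} (hu : TotallyBounded ((fun g => koopman μ g u) '' strip β c)) :
    ∃ a, u = Lp.const 2 μ a := by
  have hconst (L : ℂ →L[ℝ] ℝ) : ∃ a, (fun x => L (u x)) =ᵐ[μ] Function.const X a :=
    exists_ae_eq_const_of_superlevel
      (L.measurable.comp (Lp.stronglyMeasurable u).measurable)
      fun _ ha => hwm _ (superlevel_mem_kroneckerAlgebra μ hu L ha)
  obtain ⟨r, hr⟩ := hconst Complex.reCLM
  obtain ⟨s, hs⟩ := hconst Complex.imCLM
  refine ⟨⟨r, s⟩, Lp.ext ?_⟩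
  filter_upwards [hr, hs, Lp.coeFn_const 2 μ (⟨r, s⟩ : ℂ)] with x hre him hx
  rw [hx]
  exact Complex.ext hre him

end KroneckerAlgebra

section MeanErgodic

open scoped Pointwise

theorem average_sub_const {𝕜 E : Type*} [RCLike 𝕜] [AddCommGroup E] [Module 𝕜 E] {N : ℕ}
    (hN : N ≠ 0) (x : ℕ → E) (y : E) :
    (1 / (N : 𝕜)) • ∑ i ∈ Finset.range N, (x i - y) =
      (1 / (N : 𝕜)) • ∑ i ∈ Finset.range N, x i - y := by
  rw [Finset.sum_sub_distrib, Finset.sum_const, Finset.card_range, smul_sub,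
    ← Nat.cast_smul_eq_nsmul 𝕜 N, smul_smul, one_div_mul_cancel (Nat.cast_ne_zero.2 hN), one_smul]

theorem norm_average_sub_le {𝕜 E : Type*} [RCLike 𝕜] [SeminormedAddCommGroup E] [NormedSpace 𝕜 E]
    {N : ℕ} (hN : N ≠ 0) {x : ℕ → E} {y : E} {ε : ℝ} (hx : ∀ i, dist (x i) y ≤ ε) :
    ‖(1 / (N : 𝕜)) • ∑ i ∈ Finset.range N, x i - y‖ ≤ ε := by
  have hsum : ‖∑ i ∈ Finset.range N, (x i - y)‖ ≤ N * ε := by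
    refine (norm_sum_le_of_le _ fun i _ => (dist_eq_norm (x i) y).ge.trans (hx i)).trans_eq ?_
    rw [Finset.sum_const, Finset.card_range, nsmul_eq_mul]
  rw [← average_sub_const hN, norm_smul, norm_div, norm_one, RCLike.norm_natCast,
    one_div_mul_eq_div]
  exact (div_le_iff₀' (Nat.cast_pos.2 hN.bot_lt)).2 hsum

variable {X : Type*} [MeasurableSpace X] [AddAction (ℤ × ℤ) X] [MeasurableConstVAdd (ℤ × ℤ) X]
  (μ : Measure X) [VAddInvariantMeasure (ℤ × ℤ) X μ]

theorem IsWeakMixing.tendsto_norm_average [IsProbabilityMeasure μ] {β b c : ℝ} (hb : 0 < b)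
    (hwm : IsWeakMixing μ β c) {Q : Set (ℤ × ℤ)} (hQ : Q ⊆ strip β b)
    (hdens : 0 < lowerRelDensity β b Q) {q : ℕ → ℤ × ℤ} (hq : IsOrderedEnumeration Q q)
    (f : Lp ℂ 2 μ) :
    Tendsto (fun N : ℕ => ‖(1 / (N : ℂ)) • ∑ i ∈ Finset.range N, koopman μ (q i) f
      - Lp.const 2 μ (∫ x, f x ∂μ)‖) atTop (𝓝 0) := by
  have horth (u : Lp ℂ 2 μ) (hu : TotallyBounded ((fun g => koopman μ g u) '' strip β c)) :
      inner ℂ u (f - Lp.const 2 μ (∫ x, f x ∂μ)) = 0 := by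
    obtain ⟨a, rfl⟩ := hwm.exists_eq_const_of_totallyBounded μ hu
    rw [inner_const_left, integral_sub_const_integral, inner_zero_right]
  refine (tendsto_norm_average_of_orthogonal_to_totallyBounded_strip_orbits β
    (koopmanIsometry_add μ) horth hQ (hasLinearGrowth_of_lowerRelDensity_pos hb hdens) hq).congr' ?_
  filter_upwards [eventually_ne_atTop 0] with N hN
  simp only [koopmanIsometry_apply, koopman_sub, koopman_const, average_sub_const hN]

theorem hasLinearGrowth_returnTimes {β c : ℝ} (hc : 0 < c) {u : Lp ℂ 2 μ}
    (hu : TotallyBounded ((fun g => koopman μ g u) '' strip β c)) {b : ℝ} (hb : 0 < b) {ε : ℝ}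
    (hε : 0 < ε) : HasLinearGrowth {g ∈ strip β b | dist (koopman μ g u) u < ε} := by
  let c' := min c (b / 2)
  have hu' : TotallyBounded ((fun g => koopman μ g u) '' strip β c') :=
    hu.subset (Set.image_mono (strip_mono β (min_le_left _ _)))
  obtain ⟨P, hPstrip, hP⟩ := exists_finset_dist_lt_of_totallyBounded_image hu' hε
  obtain ⟨F, hF⟩ := exists_finset_strip_subset_add_strip β 1 (lt_min hc (half_pos hb) : 0 < c')
  have hreturn : strip β c' ⊆ P + {g ∈ strip β b | dist (koopman μ g u) u < ε} := by
    intro g hg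
    obtain ⟨p, hp, hgp⟩ := hP g hg
    refine ⟨p, hp, g - p, ⟨strip_mono β ?_ (sub_mem_strip hg (hPstrip hp)), ?_⟩,
      add_sub_cancel p g⟩
    · linarith [min_le_right c (b / 2)]
    · rwa [← dist_koopman_koopman]
  refine hasLinearGrowth_of_strip_subset_add (Set.sep_subset _ _) (F := F + P) ?_
  rw [Finset.coe_add, add_assoc]
  exact hF.trans (Set.add_subset_add_left hreturn)

theorem injOn_natAbs_fst {β b : ℝ} (hb : b < 1) :
    Set.InjOn (fun g : ℤ × ℤ => g.1.natAbs) {g ∈ strip β b | 0 ≤ g.1} := by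
  rintro g ⟨hg, hg0⟩ h ⟨hh, hh0⟩ hgh
  have hfst : g.1 = h.1 := by
    rwa [← Int.natAbs_inj_of_nonneg_of_nonneg hg0 hh0]
  have hheight := mem_strip_iff.1 (sub_mem_strip hg hh)
  rw [height_apply, Prod.fst_sub, hfst, sub_self, Int.cast_zero, mul_zero, sub_zero,
    add_self_div_two] at hheight
  have hsnd : |(g - h).2| < 1 := by exact_mod_cast hheight.trans_lt hb
  exact Prod.ext hfst (sub_eq_zero.1 (Int.abs_lt_one_iff.1 hsnd))

/-- Narrowing the strip below width `1` and dropping the negative first coordinates, which the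
density ignores, leaves at most one return time over each first coordinate. -/
theorem exists_isOrderedEnumeration_returnTimes {β b c : ℝ} (hb : 0 < b) (hc : 0 < c)
    {u : Lp ℂ 2 μ} (hu : TotallyBounded ((fun g => koopman μ g u) '' strip β c)) {ε : ℝ}
    (hε : 0 < ε) :
    ∃ Q : Set (ℤ × ℤ), Q ⊆ strip β b ∧ Q.Infinite ∧ 0 < lowerRelDensity β b Q ∧
      (∀ g ∈ Q, dist (koopman μ g u) u < ε) ∧ ∃ q, IsOrderedEnumeration Q q := by
  let b' := min b (1 / 2)
  let R : Set (ℤ × ℤ) := {g ∈ strip β b' | dist (koopman μ g u) u < ε}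
  let Q : Set (ℤ × ℤ) := R ∩ {g | 0 ≤ g.1}
  have hQb : Q ⊆ strip β b := fun g hg => strip_mono β (min_le_left _ _) hg.1.1
  have hslab (k : ℕ) : Q ∩ slab k = R ∩ slab k := by
    have hsub : slab k ⊆ {g | 0 ≤ g.1} := fun _ hg => hg.1
    rw [Set.inter_assoc, Set.inter_eq_right.2 hsub]
  have hgrow : HasLinearGrowth Q := by
    simpa only [HasLinearGrowth, hslab] using
      hasLinearGrowth_returnTimes μ hc hu (lt_min hb one_half_pos) hε
  have hinj : Set.InjOn (fun g => g.1.natAbs) Q :=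
    (injOn_natAbs_fst ((min_le_right _ _).trans_lt one_half_lt_one)).mono
      fun g hg => (⟨hg.1.1, hg.2⟩ : g ∈ strip β b' ∧ 0 ≤ g.1)
  exact ⟨Q, hQb, hgrow.infinite, hgrow.lowerRelDensity_pos hQb, fun g hg => hg.1.2,
    exists_isOrderedEnumeration hgrow.infinite hinj⟩

theorem isWeakMixing_of_tendsto_norm_average [IsFiniteMeasure μ] {β b c : ℝ}
    (hb : 0 < b) (hc : 0 < c)
    (h : ∀ Q : Set (ℤ × ℤ), Q ⊆ strip β b → Q.Infinite → 0 < lowerRelDensity β b Q →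
      ∀ q : ℕ → ℤ × ℤ, IsOrderedEnumeration Q q → ∀ f : Lp ℂ 2 μ,
        Tendsto (fun N : ℕ => ‖(1 / (N : ℂ)) • ∑ i ∈ Finset.range N, koopman μ (q i) f
          - Lp.const 2 μ (∫ x, f x ∂μ)‖) atTop (𝓝 0)) :
    IsWeakMixing μ β c := by
  intro B hBK
  obtain ⟨hB, hu⟩ := (mem_kroneckerAlgebra_iff μ).1 hBK
  let u : Lp ℂ 2 μ := indicatorConstLp 2 hB (measure_ne_top μ B) 1
  suffices hconst : u = Lp.const 2 μ (∫ x, u x ∂μ) from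
    ae_eq_empty_or_univ_of_indicatorConstLp_eq_const hB hconst
  refine dist_le_zero.1 (le_of_forall_pos_le_add fun ε hε => ?_)
  obtain ⟨Q, hQ, hinf, hdens, hreturn, q, hq⟩ :=
    exists_isOrderedEnumeration_returnTimes μ hb hc hu hε
  have hlim := (h Q hQ hinf hdens q hq u).const_add ε
  rw [add_zero] at hlim
  rw [zero_add]
  refine ge_of_tendsto hlim ?_
  filter_upwards [eventually_ne_atTop 0] with N hN
  let A := (1 / (N : ℂ)) • ∑ i ∈ Finset.range N, koopman μ (q i) u
  have hA : dist u A ≤ ε := by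
    rw [dist_comm, dist_eq_norm]
    exact norm_average_sub_le hN fun i => (hreturn _ (hq.range_eq ▸ Set.mem_range_self i)).le
  calc dist u (Lp.const 2 μ (∫ x, u x ∂μ)) ≤ dist u A + dist A _ := dist_triangle _ _ _
    _ ≤ ε + ‖A - Lp.const 2 μ (∫ x, u x ∂μ)‖ := add_le_add hA (dist_eq_norm _ _).le

end MeanErgodic

end DirectionalWeakMixing

theorem mainTheorem6_general {X : Type*} [MeasurableSpace X] [AddAction (ℤ × ℤ) X]
    [MeasurableConstVAdd (ℤ × ℤ) X] (μ : Measure X) [IsProbabilityMeasure μ]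
    [VAddInvariantMeasure (ℤ × ℤ) X μ] (β b c : ℝ) (hb : 0 < b) (hc : 0 < c) :
    DirectionalWeakMixing.IsWeakMixing μ β c ↔
      ∀ Q : Set (ℤ × ℤ), Q ⊆ DirectionalWeakMixing.strip β b → Q.Infinite →
        0 < DirectionalWeakMixing.lowerRelDensity β b Q →
        ∀ q : ℕ → ℤ × ℤ, DirectionalWeakMixing.IsOrderedEnumeration Q q →
        ∀ f : Lp ℂ 2 μ,
          Tendsto (fun N : ℕ =>
            ‖(1 / (N : ℂ)) • ∑ i ∈ Finset.range N, DirectionalWeakMixing.koopman μ (q i) f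
              - Lp.const 2 μ (∫ x, f x ∂μ)‖) atTop (𝓝 0) :=
  ⟨fun hwm _ hQ _ hdens _ hq f => hwm.tendsto_norm_average μ hb hQ hdens hq f,
    DirectionalWeakMixing.isWeakMixing_of_tendsto_norm_average μ hb hc⟩

theorem mainTheorem6 {X : Type*} [MetricSpace X] [CompactSpace X] [MeasurableSpace X] [BorelSpace X]
    [AddAction (ℤ × ℤ) X] [ContinuousConstVAdd (ℤ × ℤ) X]
    (μ : Measure X) [IsProbabilityMeasure μ] [VAddInvariantMeasure (ℤ × ℤ) X μ]
    (β b c : ℝ) (hb : 0 < b) (hc : 0 < c) :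
    DirectionalWeakMixing.IsWeakMixing μ β c ↔
      ∀ Q : Set (ℤ × ℤ), Q ⊆ DirectionalWeakMixing.strip β b → Q.Infinite →
        0 < DirectionalWeakMixing.lowerRelDensity β b Q →
        ∀ q : ℕ → ℤ × ℤ, DirectionalWeakMixing.IsOrderedEnumeration Q q →
        ∀ f : Lp ℂ 2 μ,
          Tendsto (fun N : ℕ =>
            ‖(1 / (N : ℂ)) • ∑ i ∈ Finset.range N, DirectionalWeakMixing.koopman μ (q i) f
              - Lp.const 2 μ (∫ x, f x ∂μ)‖) atTop (𝓝 0) :=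
  mainTheorem6_general μ β b c hb hc
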